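/- Let $n\ge 1$, $b>0$, $m\in\mathbb R$ with $b^2\ge 4m^2$, let $R>0$, and let $p,q>1$ satisfy $$\theta=\theta(n,p,q):=\frac{1}{pq-1}-\frac{n-1}{2}\ \ge 0 .$$ Let $u_0,v_0\in C^2(\mathbb R^n)$ and $u_1,v_1\in C^1(\mathbb R^n)$ be nonnegative with supports contained in the closed ball $B_R$ of radius $R$ about the origin, and let $v_1\not\equiv 0$. For $\varepsilon>0$ consider the Cauchy problem $$\begin{cases}\partial_t^2u-\Delta u+b\,\partial_tu+m^2u=|\partial_tv|^p, & x\in\mathbb R^n,\ t\in(0,T),\\ \partial_t^2v-\Delta v=|\partial_tu|^q, & x\in\mathbb R^n,\ t\in(0,T),\\ (u,\partial_tu)(0,\cdot)=\varepsilon(u_0,u_1),\quad (v,\partial_tv)(0,\cdot)=\varepsilon(v_0,v_1).\end{cases}$$ For $T\in(0,\infty]$, a solution on $[0,T)$ is a pair $u,v\in C([0,T)\times\mathbb R^n)$ with $u(0,\cdot)=\varepsilon u_0$, $v(0,\cdot)=\varepsilon v_0$, having weak time derivatives with $\partial_tu,\partial_tv,|\partial_tu|^q,|\partial_tv|^p\in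 L^1_{\mathrm{loc}}([0,T)\times\mathbb R^n)$, such that for every $\varphi\in C_c^\infty([0,T)\times\mathbb R^n)$ $$\int_0^T\!\!\int_{\mathbb R^n}u\,(\partial_t^2\varphi-\Delta\varphi-b\,\partial_t\varphi+m^2\varphi)\,dx\,dt=\int_0^T\!\!\int_{\mathbb R^n}|\partial_tv|^p\varphi\,dx\,dt+\varepsilon\int_{\mathbb R^n}\big((u_1+bu_0)\varphi(0,\cdot)-u_0\,\partial_t\varphi(0,\cdot)\big)dx,$$ $$\int_0^T\!\!\int_{\mathbb R^n}v\,(\partial_t^2\varphi-\Delta\varphi)\,dx\,dt=\int_0^T\!\!\int_{\mathbb R^n}|\partial_tu|^q\varphi\,dx\,dt+\varepsilon\int_{\mathbb R^n}\big(v_1\varphi(0,\cdot)-v_0\,\partial_t\varphi(0,\cdot)\big)dx.$$ (In particular, every classical solution is a solution.) Then there exist constants $\varepsilon_0>0$ and $C>0$, depending only on $n,p,q,b,R,v_1$, such that for every $\varepsilon\in(0,\varepsilon_0]$, every $T\in(0,\infty]$ and every solution $(u,v)$ on $[0,T)$ with $$\operatorname{supp}u(t,\cdot),\ \operatorname{supp}v(t,\cdot)\subset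 B_{R+t}\qquad\text{for all }t\in[0,T),$$ one has $T<\infty$, and moreover $$T\le\begin{cases}C\,\varepsilon^{-1/\theta} & \text{if }\theta>0,\\ \exp\!\big(C\,\varepsilon^{-(pq-1)}\big) & \text{if }\theta=0.\end{cases}$$ That is, $(u,v)$ blows up in finite time and its lifespan $T(\varepsilon)$ obeys this upper bound. -/

import Mathlib

open MeasureTheory Set
open scoped ContDiff

noncomputable section

namespace Nakao

/-- The Euclidean space `ℝⁿ`. -/
abbrev Space (n : ℕ) : Type := EuclideanSpace ℝ (Fin n)

/-- The space-time slab `[0, T) × ℝⁿ`, where `T = ⊤` is allowed. -/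
def slab (n : ℕ) (T : EReal) : Set (ℝ × Space n) :=
  {z | 0 ≤ z.1 ∧ (z.1 : EReal) < T}

/-- The classical time derivative `∂ₜφ` (used for smooth test functions only). -/
def timeDeriv {n : ℕ} (φ : ℝ × Space n → ℝ) (z : ℝ × Space n) : ℝ :=
  deriv (fun s : ℝ => φ (s, z.2)) z.1

/-- The Laplacian `Δφ` in the space variables (used for smooth test functions only). -/
def spaceLaplacian {n : ℕ} (φ : ℝ × Space n → ℝ) (z : ℝ × Space n) : ℝ :=
  Laplacian.laplacian (fun y : Space n => φ (z.1, y)) z.2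

/-- Test functions on `[0, T) × ℝⁿ`: restrictions of smooth functions whose support is a compact
subset of `(-∞, T) × ℝⁿ`. They need not vanish at `t = 0`. -/
structure IsTestFunction (n : ℕ) (T : EReal) (φ : ℝ × Space n → ℝ) : Prop where
  smooth : ContDiff ℝ ∞ φ
  compact : HasCompactSupport φ
  supp : tsupport φ ⊆ {z | (z.1 : EReal) < T}

/-- `w` is the weak time derivative of `u` in `(0, T) × ℝⁿ`, and `w ∈ L¹_loc([0, T) × ℝⁿ)`. -/
structure HasWeakTimeDeriv (n : ℕ) (T : EReal) (u w : ℝ × Space n → ℝ) : Prop where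
  locallyIntegrable : LocallyIntegrableOn w (slab n T)
  integral_eq : ∀ φ : ℝ × Space n → ℝ, IsTestFunction n T φ → tsupport φ ⊆ {z | 0 < z.1} →
    ∫ z in slab n T, u z * timeDeriv φ z = -∫ z in slab n T, w z * φ z

/-- The distributional form of the Cauchy problem
`∂ₜ²u - Δu + b ∂ₜu + c u = F` in `(0, T) × ℝⁿ`, `u(0, ·) = f`, `∂ₜu(0, ·) = g`. -/
def SolvesWeakly (n : ℕ) (T : EReal) (b c : ℝ) (F : ℝ × Space n → ℝ) (f g : Space n → ℝ)
    (u : ℝ × Space n → ℝ) : Prop :=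
  ∀ φ : ℝ × Space n → ℝ, IsTestFunction n T φ →
    ∫ z in slab n T,
        u z * (timeDeriv (timeDeriv φ) z - spaceLaplacian φ z - b * timeDeriv φ z + c * φ z) =
      (∫ z in slab n T, F z * φ z) +
        ∫ x : Space n, ((g x + b * f x) * φ (0, x) - f x * timeDeriv φ (0, x))

/-- `(u, v)` is a (weak, continuous) solution on `[0, T) × ℝⁿ` of
`∂ₜ²u - Δu + b ∂ₜu + m² u = |∂ₜv|ᵖ`, `∂ₜ²v - Δv = |∂ₜu|^q` with
`(u, ∂ₜu)(0, ·) = (f₀, f₁)` and `(v, ∂ₜv)(0, ·) = (g₀, g₁)`. The functions `ut`, `vt` are the weak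
time derivatives; the nonlinear terms are locally integrable up to `t = 0`. -/
structure IsSolution (n : ℕ) (b m p q : ℝ) (f₀ f₁ g₀ g₁ : Space n → ℝ) (T : EReal)
    (u v : ℝ × Space n → ℝ) : Prop where
  continuous_u : ContinuousOn u (slab n T)
  continuous_v : ContinuousOn v (slab n T)
  initial_u : ∀ x, u (0, x) = f₀ x
  initial_v : ∀ x, v (0, x) = g₀ x
  system : ∃ ut vt : ℝ × Space n → ℝ,
    HasWeakTimeDeriv n T u ut ∧ HasWeakTimeDeriv n T v vt ∧
    LocallyIntegrableOn (fun z => |ut z| ^ q) (slab n T) ∧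
    LocallyIntegrableOn (fun z => |vt z| ^ p) (slab n T) ∧
    SolvesWeakly n T b (m ^ 2) (fun z => |vt z| ^ p) f₀ f₁ u ∧
    SolvesWeakly n T 0 0 (fun z => |ut z| ^ q) g₀ g₁ v

/-- `supp u(t, ·) ⊆ B_{R + t}` for all `t ∈ [0, T)`. -/
def SupportedInCone (n : ℕ) (R : ℝ) (T : EReal) (u : ℝ × Space n → ℝ) : Prop :=
  ∀ t : ℝ, 0 ≤ t → (t : EReal) < T →
    tsupport (fun x : Space n => u (t, x)) ⊆ Metric.closedBall 0 (R + t)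

/-- The exponent `θ(n, p, q) = 1 / (pq - 1) - (n - 1) / 2`. -/
def theta (n : ℕ) (p q : ℝ) : ℝ := 1 / (p * q - 1) - ((n : ℝ) - 1) / 2

end Nakao

end

/-
Fix a direction `a` and a rate `l > |m|`. The plane exponential `e^{l x_a}` is positive, satisfies
`Δφ = l² φ`, and its integral over the section `B_{R + t}` of the cone is
`O(e^{lt} (R + t)^{(n - 1) / 2})`. Testing both equations against it turns them into linear ODEs
with constant coefficients and nonnegative sources, for the weighted means of `u` and `v`. For each
of them one characteristic root is positive and the other negative, so the solution formulas bound
the weighted means of `∂ₜu` and `∂ₜv` from below by exponential primitives of the sources; in the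
first equation only the decaying primitive is used, which remembers just the last unit of time, and
this suffices.

Jensen's inequality returns these bounds to the sources `|∂ₜv|ᵖ` and `|∂ₜu|^q`. The quantity
`H(t) = J + ∫₀ᵗ e^{-ls} N(s) ds`, with `N` the weighted mean of `|∂ₜu|^q` and `J` the moment of the
initial velocity, then satisfies, for delays `τ ≤ 1`, a delayed form of
`H' ≥ K τ^q (R + t)^{-(n - 1)(pq - 1) / 2} H^{pq}`. The power of `R + t` is integrable at infinity
unless its exponent is at least `-1`, which is the condition `θ ≥ 0`. Under it `H` doubles over
successive slices whose logarithmic lengths, like the delays, form a convergent geometric series, so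
that `H` cannot stay finite; the scaling `J ∝ ε` gives the bound on the lifespan.
-/

noncomputable section

namespace Nakao

section LogSlicing

/-- The ratio `ρ` of the geometric delays `ρ ^ j` in the slicing argument, chosen so that
`(ρ ^ j) ^ (q + 1) * (2 ^ j) ^ P = 2 ^ j`: the shrinking of the delays is exactly compensated by the
doubling of the solution. -/
def sliceRatio (P q : ℝ) : ℝ := 2 ^ (-((P - 1) / (q + 1)))

/-- The slicing times `t_{j+1} = (t_j + ρ ^ j) * exp (L * ρ ^ j)`; a solution of the integral
inequality in `lt_of_log_slicing` doubles from one to the next. -/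
def sliceTime (T₀ L ρ : ℝ) : ℕ → ℝ
  | 0 => T₀
  | j + 1 => (sliceTime T₀ L ρ j + ρ ^ j) * Real.exp (L * ρ ^ j)

variable {P q T₀ L ρ : ℝ}

theorem sliceRatio_pos : 0 < sliceRatio P q := Real.rpow_pos_of_pos two_pos _

theorem sliceRatio_lt_one (hP : 1 < P) (hq : 0 ≤ q) : sliceRatio P q < 1 :=
  Real.rpow_lt_one_of_one_lt_of_neg one_lt_two
    (neg_lt_zero.2 (div_pos (sub_pos.2 hP) (by linarith)))

theorem sliceRatio_pow_rpow_mul (hq : 0 ≤ q) {h : ℝ} (hh : 0 < h) (j : ℕ) :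
    (sliceRatio P q ^ j) ^ q * sliceRatio P q ^ j * (2 ^ j * h) ^ P =
      2 ^ j * h * h ^ (P - 1) := by
  have hdelay : (sliceRatio P q ^ j) ^ q * sliceRatio P q ^ j = ((2 : ℝ) ^ j) ^ (-(P - 1)) := by
    rw [← Real.rpow_add_one (pow_pos sliceRatio_pos j).ne', sliceRatio, ← Real.rpow_natCast,
      ← Real.rpow_natCast, ← Real.rpow_mul two_pos.le, ← Real.rpow_mul two_pos.le,
      ← Real.rpow_mul two_pos.le]
    congr 1
    field_simp
  have hdouble : (2 ^ j * h) ^ P = (2 ^ j * h) ^ (P - 1) * (2 ^ j * h) := by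
    rw [← Real.rpow_add_one (by positivity), sub_add_cancel]
  rw [hdelay, hdouble, Real.mul_rpow (by positivity) hh.le, Real.rpow_neg (by positivity)]
  field_simp

theorem le_sliceTime (hT₀ : 0 ≤ T₀) (hL : 0 ≤ L) (hρ : 0 ≤ ρ) (j : ℕ) :
    T₀ ≤ sliceTime T₀ L ρ j := by
  induction j with
  | zero => exact le_rfl
  | succ j ih =>
    calc T₀ ≤ sliceTime T₀ L ρ j + ρ ^ j := by linarith [pow_nonneg hρ j]
      _ ≤ sliceTime T₀ L ρ (j + 1) :=
        le_mul_of_one_le_right (by linarith [pow_nonneg hρ j]) (Real.one_le_exp (by positivity))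

theorem add_pow_le_sliceTime_succ (hT₀ : 0 ≤ T₀) (hL : 0 ≤ L) (hρ : 0 ≤ ρ) (j : ℕ) :
    sliceTime T₀ L ρ j + ρ ^ j ≤ sliceTime T₀ L ρ (j + 1) :=
  le_mul_of_one_le_right (by linarith [le_sliceTime hT₀ hL hρ j, pow_nonneg hρ j])
    (Real.one_le_exp (by positivity))

theorem sliceTime_le_mul_exp_sum (hT₀ : 1 ≤ T₀) (hL : 1 ≤ L) (hρ : 0 ≤ ρ) (j : ℕ) :
    sliceTime T₀ L ρ j ≤ T₀ * Real.exp (2 * L * ∑ i ∈ Finset.range j, ρ ^ i) := by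
  induction j with
  | zero => simp [sliceTime]
  | succ j ih =>
    have hs : 1 ≤ sliceTime T₀ L ρ j := hT₀.trans (le_sliceTime (by linarith) (by linarith) hρ j)
    have hdelay : sliceTime T₀ L ρ j + ρ ^ j ≤ sliceTime T₀ L ρ j * Real.exp (L * ρ ^ j) := by
      have hexp : 1 + ρ ^ j ≤ Real.exp (L * ρ ^ j) := by
        nlinarith [Real.add_one_le_exp (L * ρ ^ j), pow_nonneg hρ j]
      nlinarith [pow_nonneg hρ j]
    calc sliceTime T₀ L ρ (j + 1)
        ≤ sliceTime T₀ L ρ j * Real.exp (L * ρ ^ j) * Real.exp (L * ρ ^ j) := by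
          rw [sliceTime]; gcongr
      _ ≤ T₀ * Real.exp (2 * L * ∑ i ∈ Finset.range j, ρ ^ i) * Real.exp (L * ρ ^ j) *
            Real.exp (L * ρ ^ j) := by gcongr
      _ = T₀ * Real.exp (2 * L * ∑ i ∈ Finset.range (j + 1), ρ ^ i) := by
          rw [mul_assoc, mul_assoc, ← Real.exp_add, ← Real.exp_add, Finset.sum_range_succ]
          ring_nf

theorem sliceTime_le (hT₀ : 1 ≤ T₀) (hL : 1 ≤ L) (hρ : 0 ≤ ρ) (hρ1 : ρ < 1) (j : ℕ) :
    sliceTime T₀ L ρ j ≤ T₀ * Real.exp (2 * L * (1 - ρ)⁻¹) := by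
  have hsum : ∑ i ∈ Finset.range j, ρ ^ i ≤ (1 - ρ)⁻¹ := by
    rw [← tsum_geometric_of_lt_one hρ hρ1]
    exact (summable_geometric_of_lt_one hρ hρ1).sum_le_tsum _ fun i _ => pow_nonneg hρ i
  refine (sliceTime_le_mul_exp_sum hT₀ hL hρ j).trans ?_
  gcongr

theorem log_sliceTime_succ_div (hT₀ : 0 < T₀) (hL : 0 ≤ L) (hρ : 0 ≤ ρ) (j : ℕ) :
    Real.log (sliceTime T₀ L ρ (j + 1) / (sliceTime T₀ L ρ j + ρ ^ j)) = L * ρ ^ j := by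
  have hpos : 0 < sliceTime T₀ L ρ j + ρ ^ j := by
    linarith [le_sliceTime hT₀.le hL hρ j, pow_nonneg hρ j]
  rw [sliceTime, mul_div_cancel_left₀ _ hpos.ne', Real.log_exp]

variable {K h₀ B : ℝ} {H : ℝ → ℝ}

theorem two_pow_mul_le_of_log_slicing (hP : 1 < P) (hq : 0 ≤ q) (hK : 0 < K) (hh₀ : 0 < h₀)
    (hT₀ : 1 ≤ T₀) (hL : 1 ≤ L) (hB : ∀ j, sliceTime T₀ L (sliceRatio P q) j ≤ B)
    (h0 : h₀ ≤ H T₀)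
    (hH : ∀ t₀ t₁ τ, T₀ ≤ t₀ → 0 < τ → τ ≤ 1 → t₀ + τ ≤ t₁ → t₁ ≤ B →
      H t₀ + K * τ ^ q * H t₀ ^ P * Real.log (t₁ / (t₀ + τ)) ≤ H t₁)
    (hcond : 1 ≤ K * L * h₀ ^ (P - 1)) (j : ℕ) :
    2 ^ j * h₀ ≤ H (sliceTime T₀ L (sliceRatio P q) j) := by
  set ρ := sliceRatio P q
  have hρ : 0 < ρ := sliceRatio_pos
  induction j with
  | zero => simpa [sliceTime] using h0
  | succ j ih =>
    set s := sliceTime T₀ L ρ j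
    have hs : T₀ ≤ s := le_sliceTime (by linarith) (by linarith) hρ.le j
    have hnext : s + ρ ^ j ≤ sliceTime T₀ L ρ (j + 1) :=
      add_pow_le_sliceTime_succ (by linarith) (by linarith) hρ.le j
    have hstep := hH s (sliceTime T₀ L ρ (j + 1)) (ρ ^ j) hs (by positivity)
      (pow_le_one₀ hρ.le (sliceRatio_lt_one hP hq).le) hnext (hB _)
    rw [log_sliceTime_succ_div (by linarith) (by linarith) hρ.le] at hstep
    have hgain : 2 ^ j * h₀ ≤ K * (ρ ^ j) ^ q * H s ^ P * (L * ρ ^ j) :=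
      calc 2 ^ j * h₀ ≤ 2 ^ j * h₀ * (K * L * h₀ ^ (P - 1)) :=
            le_mul_of_one_le_right (by positivity) hcond
        _ = K * (ρ ^ j) ^ q * (2 ^ j * h₀) ^ P * (L * ρ ^ j) := by
            linear_combination (-(K * L)) * sliceRatio_pow_rpow_mul (P := P) hq hh₀ j
        _ ≤ K * (ρ ^ j) ^ q * H s ^ P * (L * ρ ^ j) := by gcongr
    rw [pow_succ]
    linarith

/-- In logarithmic time the slices have length about `ρ ^ j`, so they accumulate at a finite time,
by which `H` has doubled infinitely often. -/
theorem lt_of_log_slicing (hP : 1 < P) (hq : 0 ≤ q) (hK : 0 < K) (hh₀ : 0 < h₀) (hT₀ : 1 ≤ T₀)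
    (hL : 1 ≤ L) (h0 : h₀ ≤ H T₀)
    (hH : ∀ t₀ t₁ τ, T₀ ≤ t₀ → 0 < τ → τ ≤ 1 → t₀ + τ ≤ t₁ → t₁ ≤ B →
      H t₀ + K * τ ^ q * H t₀ ^ P * Real.log (t₁ / (t₀ + τ)) ≤ H t₁)
    (hcond : 1 ≤ K * L * h₀ ^ (P - 1)) :
    B < T₀ * Real.exp (2 * L * (1 - sliceRatio P q)⁻¹) := by
  have hρ : 0 < sliceRatio P q := sliceRatio_pos
  by_contra! hB
  have hslice : ∀ j, sliceTime T₀ L (sliceRatio P q) j ≤ B := fun j =>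
    (sliceTime_le hT₀ hL hρ.le (sliceRatio_lt_one hP hq) j).trans hB
  have hdouble := two_pow_mul_le_of_log_slicing hP hq hK hh₀ hT₀ hL hslice h0 hH hcond
  obtain ⟨j, hj⟩ := pow_unbounded_of_one_lt (H B / h₀) one_lt_two
  set s := sliceTime T₀ L (sliceRatio P q) j
  have hs : T₀ ≤ s := le_sliceTime (by linarith) (by linarith) hρ.le j
  have hHs : 0 ≤ H s := le_trans (by positivity) (hdouble j)
  have hnext : s + sliceRatio P q ^ j ≤ B :=
    (add_pow_le_sliceTime_succ (by linarith) (by linarith) hρ.le j).trans (hslice (j + 1))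
  have hlog : 0 ≤ Real.log (B / (s + sliceRatio P q ^ j)) :=
    Real.log_nonneg ((one_le_div (by linarith [pow_pos hρ j])).2 hnext)
  have hle : H s ≤ H B := le_trans (le_add_of_nonneg_right (by positivity))
    (hH s B _ hs (by positivity) (pow_le_one₀ hρ.le (sliceRatio_lt_one hP hq).le) hnext le_rfl)
  rw [div_lt_iff₀ hh₀] at hj
  linarith [hdouble j]

end LogSlicing

section PlaneExp

theorem integrable_prod_euclideanSpace {ι : Type*} [Fintype ι] {F : ι → ℝ → ℝ}
    (hF : ∀ i, Integrable (F i)) : Integrable fun x : EuclideanSpace ℝ ι => ∏ i, F i (x i) :=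
  (PiLp.volume_preserving_ofLp ι).integrable_comp_of_integrable
    (g := fun y : ι → ℝ => ∏ i, F i (y i)) (Integrable.fintype_prod hF)

theorem integral_prod_euclideanSpace {ι : Type*} [Fintype ι] (F : ι → ℝ → ℝ) :
    ∫ x : EuclideanSpace ℝ ι, ∏ i, F i (x i) = ∏ i, ∫ s, F i s := by
  rw [← integral_fintype_prod_volume_eq_prod]
  exact (PiLp.volume_preserving_ofLp ι).integral_comp
    (MeasurableEquiv.toLp 2 (ι → ℝ)).symm.measurableEmbedding
    (fun y : ι → ℝ => ∏ i, F i (y i))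

variable {n : ℕ} {a : Fin n} {l r : ℝ}

/-- The plane exponential `e^{l x_a}`, a positive solution of `Δφ = l² φ`; solutions of the system
are tested against it. -/
def planeExp (a : Fin n) (l : ℝ) (x : Space n) : ℝ := Real.exp (l * x a)

theorem planeExp_pos (x : Space n) : 0 < planeExp a l x := Real.exp_pos _

theorem contDiff_planeExp {k : WithTop ℕ∞} : ContDiff ℝ k (planeExp a l) := by
  unfold planeExp
  fun_prop

@[fun_prop]
theorem continuous_planeExp : Continuous (planeExp a l) :=
  contDiff_planeExp (k := 0).continuous

/-- The factors of a majorant of `planeExp a l` on the ball of radius `r`, which splits over the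
coordinates: for `‖x‖ ≤ r` one has `x_a ≤ (r + x_a) / 2 - ∑_{i ≠ a} x_i ^ 2 / (4 r)`. -/
def expMajorant (a : Fin n) (l r : ℝ) (i : Fin n) : ℝ → ℝ :=
  if i = a then (Iic r).indicator fun s => Real.exp (l / 2 * s)
  else fun s => Real.exp (-(l / (4 * r)) * s ^ 2)

theorem expMajorant_self : expMajorant a l r a = (Iic r).indicator fun s => Real.exp (l / 2 * s) :=
  if_pos rfl

theorem expMajorant_of_ne {i : Fin n} (hi : i ≠ a) :
    expMajorant a l r i = fun s => Real.exp (-(l / (4 * r)) * s ^ 2) :=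
  if_neg hi

theorem expMajorant_nonneg (i : Fin n) (s : ℝ) : 0 ≤ expMajorant a l r i s := by
  obtain rfl | hi := eq_or_ne i a
  · rw [expMajorant_self]
    exact indicator_nonneg (fun _ _ => (Real.exp_pos _).le) _
  · rw [expMajorant_of_ne hi]
    positivity

theorem integrable_expMajorant (hl : 0 < l) (hr : 0 < r) (i : Fin n) :
    Integrable (expMajorant a l r i) := by
  obtain rfl | hi := eq_or_ne i a
  · rw [expMajorant_self, integrable_indicator_iff measurableSet_Iic]
    exact integrableOn_exp_mul_Iic (by positivity) r
  · rw [expMajorant_of_ne hi]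
    exact integrable_exp_neg_mul_sq (by positivity)

theorem prod_integral_expMajorant (hl : 0 < l) (hr : 0 < r) :
    ∏ i, ∫ s, expMajorant a l r i s =
      2 / l * √(4 * Real.pi / l) ^ (n - 1) * Real.exp (l * r / 2) * r ^ (((n : ℝ) - 1) / 2) := by
  have haxis : ∫ s, expMajorant a l r a s = 2 / l * Real.exp (l * r / 2) := by
    rw [expMajorant_self, integral_indicator measurableSet_Iic,
      integral_exp_mul_Iic (by positivity)]
    field_simp
  have hcross : ∀ i ∈ ({a} : Finset (Fin n))ᶜ,
      ∫ s, expMajorant a l r i s = √(4 * Real.pi / l) * √r := fun i hi => by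
    rw [expMajorant_of_ne (by simpa using hi), integral_gaussian, ← Real.sqrt_mul (by positivity)]
    congr 1
    field_simp
  have hsqrt : √r ^ (n - 1) = r ^ (((n : ℝ) - 1) / 2) := by
    rw [Real.sqrt_eq_rpow, ← Real.rpow_natCast, ← Real.rpow_mul hr.le, Nat.cast_sub a.pos]
    congr 1
    push_cast
    ring
  rw [Fintype.prod_eq_mul_prod_compl a, haxis, Finset.prod_congr rfl hcross, Finset.prod_const,
    Finset.card_compl, Finset.card_singleton, Fintype.card_fin, mul_pow, hsqrt]
  ring

theorem planeExp_le_mul_prod_expMajorant (hl : 0 < l) (hr : 0 < r) {x : Space n} (hx : ‖x‖ ≤ r) :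
    planeExp a l x ≤ Real.exp (l * r / 2) * ∏ i, expMajorant a l r i (x i) := by
  set S := ∑ i ∈ ({a} : Finset (Fin n))ᶜ, x i ^ 2
  have hS : x a ^ 2 + S ≤ r ^ 2 := by
    rw [← Fintype.sum_eq_add_sum_compl a fun i => x i ^ 2, ← EuclideanSpace.real_norm_sq_eq]
    gcongr
  have hxa : |x a| ≤ r := abs_le_of_sq_le_sq
    (by linarith [show 0 ≤ S from Finset.sum_nonneg fun i _ => sq_nonneg (x i)]) hr.le
  have hcross : ∏ i ∈ ({a} : Finset (Fin n))ᶜ, expMajorant a l r i (x i) =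
      Real.exp (-(l / (4 * r)) * S) := by
    rw [Finset.mul_sum, Real.exp_sum]
    exact Finset.prod_congr rfl fun i hi => by rw [expMajorant_of_ne (by simpa using hi)]
  have hparabola : l / (4 * r) * S ≤ l / 2 * (r - x a) :=
    calc l / (4 * r) * S ≤ l / (4 * r) * (2 * r * (r - x a)) := by
          gcongr
          nlinarith [abs_le.1 hxa]
      _ = l / 2 * (r - x a) := by field_simp; ring
  rw [Fintype.prod_eq_mul_prod_compl a, hcross, expMajorant_self,
    indicator_of_mem (mem_Iic.2 (abs_le.1 hxa).2), ← Real.exp_add, ← Real.exp_add, planeExp,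
    Real.exp_le_exp]
  linarith

theorem setIntegral_planeExp_le (hl : 0 < l) (hr : 0 < r) :
    ∫ x in Metric.closedBall 0 r, planeExp a l x ≤
      2 / l * √(4 * Real.pi / l) ^ (n - 1) * Real.exp (l * r) * r ^ (((n : ℝ) - 1) / 2) := by
  have hprod : Integrable fun x : Space n =>
      Real.exp (l * r / 2) * ∏ i, expMajorant a l r i (x i) :=
    (integrable_prod_euclideanSpace (integrable_expMajorant hl hr)).const_mul _
  calc ∫ x in Metric.closedBall 0 r, planeExp a l x
      ≤ ∫ x in Metric.closedBall (0 : Space n) r,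
          Real.exp (l * r / 2) * ∏ i, expMajorant a l r i (x i) :=
        setIntegral_mono_on
          (continuous_planeExp.continuousOn.integrableOn_compact (isCompact_closedBall _ _))
          hprod.integrableOn Metric.isClosed_closedBall.measurableSet
          fun x hx => planeExp_le_mul_prod_expMajorant hl hr (mem_closedBall_zero_iff.1 hx)
    _ ≤ ∫ x : Space n, Real.exp (l * r / 2) * ∏ i, expMajorant a l r i (x i) :=
        setIntegral_le_integral hprod <| .of_forall fun x =>
          mul_nonneg (Real.exp_pos _).le (Finset.prod_nonneg fun i _ => expMajorant_nonneg i _)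
    _ = _ := by
        rw [integral_const_mul, integral_prod_euclideanSpace, prod_integral_expMajorant hl hr,
          show l * r = l * r / 2 + l * r / 2 by ring, Real.exp_add]
        ring_nf

end PlaneExp

section WeakODE

variable {α β B J : ℝ} {N η : ℝ → ℝ}

/-- The mass of the source `N`, in the weight `e^{-αs}`, accumulated from the initial value `J`. For
`α = l` and the mean `N` of `|∂ₜu|^q` it is the quantity that blows up. -/
def expMass (α J : ℝ) (N : ℝ → ℝ) (t : ℝ) : ℝ :=
  J + ∫ s in (0 : ℝ)..t, Real.exp (-α * s) * N s

/-- The solution of `Y' = α Y + N`, `Y(0) = J`. -/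
def expPrimitive (α J : ℝ) (N : ℝ → ℝ) (t : ℝ) : ℝ :=
  Real.exp (α * t) * expMass α J N t

/-- The solution of the backward problem `E' = -α E - η`, `E(B) = 0`, which is adjoint to that of
`expPrimitive`. -/
def expTail (α B : ℝ) (η : ℝ → ℝ) (t : ℝ) : ℝ :=
  Real.exp (-α * t) * ∫ s in t..B, Real.exp (α * s) * η s

theorem intervalIntegrable_exp_mul (hN : IntegrableOn N (Ioc 0 B)) {t : ℝ} (ht : t ∈ Icc 0 B) :
    IntervalIntegrable (fun s => Real.exp (-α * s) * N s) volume 0 t :=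
  IntervalIntegrable.continuousOn_mul
    ((intervalIntegrable_iff_integrableOn_Ioc_of_le ht.1).2
      (hN.mono_set (Ioc_subset_Ioc_right ht.2))) (by fun_prop)

theorem absolutelyContinuousOnInterval_expMass (hB : 0 ≤ B) (hN : IntegrableOn N (Ioc 0 B)) :
    AbsolutelyContinuousOnInterval (expMass α J N) 0 B :=
  have hconst : AbsolutelyContinuousOnInterval (fun _ => J) 0 B :=
    contDiffOn_const.absolutelyContinuousOnInterval
  hconst.add ((intervalIntegrable_exp_mul hN
    (right_mem_Icc.2 hB)).absolutelyContinuousOnInterval_intervalIntegral left_mem_uIcc)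

theorem ae_deriv_expMass (hB : 0 ≤ B) (hN : IntegrableOn N (Ioc 0 B)) :
    ∀ᵐ t, t ∈ uIcc 0 B → deriv (expMass α J N) t = Real.exp (-α * t) * N t := by
  filter_upwards [(intervalIntegrable_exp_mul (α := α) hN
    (right_mem_Icc.2 hB)).ae_hasDerivAt_integral] with t ht htB
  exact ((ht htB 0 left_mem_uIcc).const_add J).deriv

theorem continuousOn_expPrimitive (hB : 0 ≤ B) (hN : IntegrableOn N (Ioc 0 B)) :
    ContinuousOn (expPrimitive α J N) (Icc 0 B) := by
  have h := (absolutelyContinuousOnInterval_expMass (α := α) (J := J) hB hN).continuousOn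
  rw [uIcc_of_le hB] at h
  unfold expPrimitive
  fun_prop

theorem expPrimitive_eq_add_integral (α J : ℝ) (N : ℝ → ℝ) (t : ℝ) :
    expPrimitive α J N t =
      Real.exp (α * t) * J + ∫ s in (0 : ℝ)..t, Real.exp (α * (t - s)) * N s := by
  rw [expPrimitive, expMass, mul_add, ← intervalIntegral.integral_const_mul]
  congr 2
  ext s
  rw [← mul_assoc, ← Real.exp_add]
  congr 2
  ring

theorem expPrimitive_mono {J' t : ℝ} (hβα : β ≤ α) (hJ' : 0 ≤ J') (hJ : J' ≤ J)
    (hN0 : ∀ s, 0 ≤ N s) (hN : IntegrableOn N (Ioc 0 B)) (ht : t ∈ Icc 0 B) :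
    expPrimitive β J' N t ≤ expPrimitive α J N t := by
  have hi : ∀ γ : ℝ, IntervalIntegrable (fun s => Real.exp (γ * (t - s)) * N s) volume 0 t :=
    fun γ => IntervalIntegrable.continuousOn_mul
      ((intervalIntegrable_iff_integrableOn_Ioc_of_le ht.1).2
        (hN.mono_set (Ioc_subset_Ioc_right ht.2))) (by fun_prop)
  rw [expPrimitive_eq_add_integral, expPrimitive_eq_add_integral]
  refine add_le_add ?_ (intervalIntegral.integral_mono_on ht.1 (hi β) (hi α) fun s hs => ?_)
  · have := ht.1
    gcongr
  · have hts : 0 ≤ t - s := sub_nonneg.2 hs.2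
    have := hN0 s
    gcongr

theorem le_expMass {t : ℝ} (hN : ∀ s, 0 ≤ N s) (ht : 0 ≤ t) : J ≤ expMass α J N t :=
  le_add_of_nonneg_right (intervalIntegral.integral_nonneg ht
    fun s _ => mul_nonneg (Real.exp_pos _).le (hN s))

theorem expMass_nonneg {t : ℝ} (hJ : 0 ≤ J) (hN : ∀ s, 0 ≤ N s) (ht : 0 ≤ t) :
    0 ≤ expMass α J N t :=
  hJ.trans (le_expMass hN ht)

theorem expPrimitive_nonneg {t : ℝ} (hJ : 0 ≤ J) (hN : ∀ s, 0 ≤ N s) (ht : 0 ≤ t) :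
    0 ≤ expPrimitive α J N t :=
  mul_nonneg (Real.exp_pos _).le (expMass_nonneg hJ hN ht)

theorem hasDerivAt_integral_exp_mul (hη : Continuous η) (t : ℝ) :
    HasDerivAt (fun t => ∫ s in t..B, Real.exp (α * s) * η s) (-(Real.exp (α * t) * η t)) t :=
  have hc : Continuous fun s => Real.exp (α * s) * η s := by fun_prop
  intervalIntegral.integral_hasDerivAt_left (hc.intervalIntegrable _ _)
    (hc.stronglyMeasurableAtFilter _ _) hc.continuousAt

theorem contDiff_integral_exp_mul {k : ℕ∞} (hη : ContDiff ℝ k η) :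
    ContDiff ℝ (k + 1) fun t => ∫ s in t..B, Real.exp (α * s) * η s := by
  have hderiv := hasDerivAt_integral_exp_mul (α := α) (B := B) hη.continuous
  rw [contDiff_succ_iff_deriv]
  refine ⟨fun t => (hderiv t).differentiableAt, by simp, ?_⟩
  rw [funext fun t => (hderiv t).deriv]
  fun_prop

theorem hasDerivAt_expTail (hη : Continuous η) (t : ℝ) :
    HasDerivAt (expTail α B η) (-α * expTail α B η t - η t) t := by
  have hexp : HasDerivAt (fun t => Real.exp (-α * t)) (Real.exp (-α * t) * (-α * 1)) t :=
    ((hasDerivAt_id t).const_mul (-α)).exp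
  refine (hexp.mul (hasDerivAt_integral_exp_mul hη t)).congr_deriv ?_
  have hinv : Real.exp (-α * t) * Real.exp (α * t) = 1 := by rw [← Real.exp_add]; simp
  simp only [expTail]
  linear_combination (-η t) * hinv

theorem contDiff_expTail (hη : ContDiff ℝ ∞ η) : ContDiff ℝ ∞ (expTail α B η) := by
  have h : ContDiff ℝ ∞ fun t => ∫ s in t..B, Real.exp (α * s) * η s :=
    contDiff_integral_exp_mul (k := ⊤) hη
  unfold expTail
  fun_prop

theorem expTail_eq_zero {B' t : ℝ} (hB : B' ≤ B) (hη : ∀ s, B' ≤ s → η s = 0) (ht : B' ≤ t) :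
    expTail α B η t = 0 := by
  rw [expTail, intervalIntegral.integral_congr (g := fun _ => 0) fun s hs => ?_]
  · simp
  · simp only [hη s ((le_min ht hB).trans hs.1), mul_zero]

theorem integral_mul_expPrimitive (hB : 0 ≤ B) (hN : IntegrableOn N (Ioc 0 B))
    (hη : Continuous η) :
    ∫ t in Ioc 0 B, η t * expPrimitive α J N t =
      J * expTail α B η 0 + ∫ t in Ioc 0 B, N t * expTail α B η t := by
  set G : ℝ → ℝ := fun t => ∫ s in t..B, Real.exp (α * s) * η s
  have hG : AbsolutelyContinuousOnInterval G 0 B :=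
    (contDiff_integral_exp_mul (k := 0)
      (contDiff_zero.2 hη)).contDiffOn.absolutelyContinuousOnInterval
  have hparts := (absolutelyContinuousOnInterval_expMass (α := α) (J := J) hB
    hN).integral_mul_deriv_eq_deriv_mul hG
  have hleft : ∫ t in (0 : ℝ)..B, expMass α J N t * deriv G t =
      -∫ t in (0 : ℝ)..B, η t * expPrimitive α J N t := by
    rw [← intervalIntegral.integral_neg]
    refine intervalIntegral.integral_congr fun t _ => ?_
    simp only [G, (hasDerivAt_integral_exp_mul hη t).deriv, expPrimitive]
    ring
  have hright : ∫ t in (0 : ℝ)..B, deriv (expMass α J N) t * G t =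
      ∫ t in (0 : ℝ)..B, N t * expTail α B η t := by
    refine intervalIntegral.integral_congr_ae ?_
    filter_upwards [ae_deriv_expMass (α := α) (J := J) hB hN] with t ht htB
    rw [ht (uIoc_subset_uIcc htB), expTail]
    ring
  have hG0 : G 0 = expTail α B η 0 := by simp [G, expTail]
  rw [hleft, hright, hG0, show G B = 0 from intervalIntegral.integral_same] at hparts
  rw [← intervalIntegral.integral_of_le hB, ← intervalIntegral.integral_of_le hB]
  simp only [expMass, intervalIntegral.integral_same, add_zero, mul_zero, zero_sub] at hparts
  linarith

/-- The solution `ζ` of the adjoint problem `ζ'' + (α + β) ζ' + α β ζ = -η'` that vanishes at and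
after the support of `η`. -/
def adjointSolution (α β B : ℝ) (η : ℝ → ℝ) (t : ℝ) : ℝ :=
  (α * expTail α B η t - β * expTail β B η t) / (α - β)

/-- The derivative of `adjointSolution`. -/
def adjointSolutionDeriv (α β B : ℝ) (η : ℝ → ℝ) (t : ℝ) : ℝ :=
  (-α ^ 2 * expTail α B η t + β ^ 2 * expTail β B η t) / (α - β) - η t

theorem hasDerivAt_adjointSolution (hαβ : α ≠ β) (hη : Continuous η) (t : ℝ) :
    HasDerivAt (adjointSolution α β B η) (adjointSolutionDeriv α β B η t) t := by
  have hD : α - β ≠ 0 := sub_ne_zero.2 hαβ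
  refine ((((hasDerivAt_expTail hη t).const_mul α).sub
    ((hasDerivAt_expTail hη t).const_mul β)).div_const (α - β)).congr_deriv ?_
  simp only [adjointSolutionDeriv]
  field_simp
  ring

theorem hasDerivAt_adjointSolutionDeriv (hαβ : α ≠ β) (hη : ContDiff ℝ 1 η) (t : ℝ) :
    HasDerivAt (adjointSolutionDeriv α β B η)
      (-(α + β) * adjointSolutionDeriv α β B η t - α * β * adjointSolution α β B η t -
        deriv η t) t := by
  have hD : α - β ≠ 0 := sub_ne_zero.2 hαβ
  refine (((((hasDerivAt_expTail hη.continuous t).const_mul (-α ^ 2)).add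
    ((hasDerivAt_expTail hη.continuous t).const_mul (β ^ 2))).div_const (α - β)).sub
    (hη.differentiable (by simp) t).hasDerivAt).congr_deriv ?_
  simp only [adjointSolutionDeriv, adjointSolution]
  field_simp
  ring

theorem contDiff_adjointSolution (hη : ContDiff ℝ ∞ η) : ContDiff ℝ ∞ (adjointSolution α β B η) :=
  ((contDiff_const.mul (contDiff_expTail hη)).sub
    (contDiff_const.mul (contDiff_expTail hη))).div_const _

theorem exists_hasCompactSupport_eventuallyEq {ζ₀ : ℝ → ℝ} {B' : ℝ} (hζ₀ : ContDiff ℝ ∞ ζ₀)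
    (hB : B' < B) (hzero : ∀ t, B' ≤ t → ζ₀ t = 0) :
    ∃ ζ : ℝ → ℝ, ContDiff ℝ ∞ ζ ∧ HasCompactSupport ζ ∧ tsupport ζ ⊆ Iio B ∧
      ∀ t ∈ Icc 0 B, ζ =ᶠ[nhds t] ζ₀ := by
  let χ : ContDiffBump (0 : ℝ) := ⟨|B| + 1, |B| + 2, by positivity, by linarith⟩
  refine ⟨fun t => χ t * ζ₀ t, χ.contDiff.mul hζ₀, χ.hasCompactSupport.mul_right, ?_,
    fun t ht => ?_⟩
  · have hsupp : tsupport (fun t => χ t * ζ₀ t) ⊆ Iic B' :=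
      closure_minimal (fun t ht => mem_Iic.2 (not_lt.1 fun hlt => ht (by simp [hzero t hlt.le])))
        isClosed_Iic
    exact hsupp.trans (Iic_subset_Iio.2 hB)
  · have hball : t ∈ Metric.ball (0 : ℝ) χ.rIn := by
      rw [Metric.mem_ball, Real.dist_eq, sub_zero, abs_of_nonneg ht.1]
      exact lt_of_le_of_lt (ht.2.trans (le_abs_self B)) (lt_add_one _)
    filter_upwards [χ.eventuallyEq_one_of_mem_ball hball] with s hs
    simp [hs]

theorem exists_lt_forall_eq_zero_of_tsupport_subset_Iio (hη : HasCompactSupport η)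
    (hηB : tsupport η ⊆ Iio B) : ∃ B' < B, ∀ s, B' ≤ s → η s = 0 := by
  obtain hempty | hne := (tsupport η).eq_empty_or_nonempty
  · exact ⟨B - 1, by linarith, fun s _ => image_eq_zero_of_notMem_tsupport (by simp [hempty])⟩
  · obtain ⟨m, hm, hmax⟩ := hη.isCompact.exists_isGreatest hne
    have hmB : m < B := hηB hm
    refine ⟨(m + B) / 2, by linarith, fun s hs =>
      image_eq_zero_of_notMem_tsupport fun hs' => ?_⟩
    linarith [hmax hs']

theorem integral_mul_adjointSolution {I : ℝ} (hαβ : α ≠ β) (hB : 0 ≤ B)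
    (hN : IntegrableOn N (Ioc 0 B)) (hη : ContDiff ℝ ∞ η) (hη0 : η 0 = 0) :
    (∫ t in Ioc 0 B, N t * adjointSolution α β B η t) +
        ((J - (α + β) * I) * adjointSolution α β B η 0 - I * adjointSolutionDeriv α β B η 0) =
      ∫ t in Ioc 0 B, η t * ((α * expPrimitive α (J - β * I) N t -
        β * expPrimitive β (J - α * I) N t) / (α - β)) := by
  have hD : α - β ≠ 0 := sub_ne_zero.2 hαβ
  have hNE : ∀ γ, IntegrableOn (fun t => N t * expTail γ B η t) (Ioc 0 B) := fun γ =>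
    (((integrableOn_Icc_iff_integrableOn_Ioc).2 hN).mul_continuousOn
      (contDiff_expTail hη).continuous.continuousOn isCompact_Icc).mono_set Ioc_subset_Icc_self
  have hηY : ∀ γ K, IntegrableOn (fun t => η t * expPrimitive γ K N t) (Ioc 0 B) := fun γ K =>
    ((hη.continuous.continuousOn.mul (continuousOn_expPrimitive hB hN)).integrableOn_Icc).mono_set
      Ioc_subset_Icc_self
  have hleft : ∫ t in Ioc 0 B, N t * adjointSolution α β B η t =
      α / (α - β) * (∫ t in Ioc 0 B, N t * expTail α B η t) -
        β / (α - β) * ∫ t in Ioc 0 B, N t * expTail β B η t := by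
    rw [← integral_const_mul, ← integral_const_mul,
      ← integral_sub ((hNE α).const_mul _) ((hNE β).const_mul _)]
    exact integral_congr_ae <| .of_forall fun t => by simp only [adjointSolution]; ring
  have hright : ∫ t in Ioc 0 B, η t * ((α * expPrimitive α (J - β * I) N t -
        β * expPrimitive β (J - α * I) N t) / (α - β)) =
      α / (α - β) * (∫ t in Ioc 0 B, η t * expPrimitive α (J - β * I) N t) -
        β / (α - β) * ∫ t in Ioc 0 B, η t * expPrimitive β (J - α * I) N t := by
    rw [← integral_const_mul, ← integral_const_mul,
      ← integral_sub ((hηY α _).const_mul _) ((hηY β _).const_mul _)]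
    exact integral_congr_ae <| .of_forall fun t => by ring
  rw [hleft, hright, integral_mul_expPrimitive hB hN hη.continuous,
    integral_mul_expPrimitive hB hN hη.continuous]
  simp only [adjointSolution, adjointSolutionDeriv, hη0]
  field_simp
  ring

/-- `V` solves `V'' + b V' + k V = N`, `V(0) = I`, `V'(0) = J` on `[0, B)` in the sense of
distributions, and `f` is its weak derivative. -/
structure SolvesWeakODE (B b k I J : ℝ) (V f N : ℝ → ℝ) : Prop where
  integrableOn_deriv : IntegrableOn f (Ioc 0 B)
  integrableOn_source : IntegrableOn N (Ioc 0 B)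
  integral_mul_deriv : ∀ η : ℝ → ℝ, ContDiff ℝ ∞ η → HasCompactSupport η → tsupport η ⊆ Ioo 0 B →
    ∫ t in Ioc 0 B, V t * deriv η t = -∫ t in Ioc 0 B, f t * η t
  integral_mul_operator : ∀ ζ : ℝ → ℝ, ContDiff ℝ ∞ ζ → HasCompactSupport ζ → tsupport ζ ⊆ Iio B →
    ∫ t in Ioc 0 B, V t * (deriv (deriv ζ) t - b * deriv ζ t + k * ζ t) =
      (∫ t in Ioc 0 B, N t * ζ t) + ((J + b * I) * ζ 0 - I * deriv ζ 0)

namespace SolvesWeakODE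

variable {I : ℝ} {V f : ℝ → ℝ}

/-- Testing the equation with `ζ = adjointSolution` turns its left side into `-∫ V η' = ∫ f η`. -/
theorem integral_deriv_mul (h : SolvesWeakODE B (-(α + β)) (α * β) I J V f N) (hαβ : α ≠ β)
    (hB : 0 ≤ B) (hη : ContDiff ℝ ∞ η) (hηc : HasCompactSupport η) (hηB : tsupport η ⊆ Ioo 0 B) :
    ∫ t in Ioc 0 B, f t * η t =
      (∫ t in Ioc 0 B, N t * adjointSolution α β B η t) +
        ((J - (α + β) * I) * adjointSolution α β B η 0 - I * adjointSolutionDeriv α β B η 0) := by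
  obtain ⟨B', hB'B, hB'⟩ := exists_lt_forall_eq_zero_of_tsupport_subset_Iio hηc
    (hηB.trans fun _ ht => ht.2)
  obtain ⟨ζ, hζ, hζc, hζB, hloc⟩ := exists_hasCompactSupport_eventuallyEq
    (contDiff_adjointSolution (α := α) (β := β) (B := B) hη) hB'B fun t ht => by
      simp [adjointSolution, expTail_eq_zero hB'B.le hB' ht]
  have hdloc : ∀ t ∈ Icc 0 B, deriv ζ =ᶠ[nhds t] adjointSolutionDeriv α β B η := fun t ht => by
    rw [← funext fun s => (hasDerivAt_adjointSolution (B := B) hαβ hη.continuous s).deriv]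
    exact (hloc t ht).deriv
  have hoperator : ∫ t in Ioc 0 B,
      V t * (deriv (deriv ζ) t - -(α + β) * deriv ζ t + α * β * ζ t) =
        -∫ t in Ioc 0 B, V t * deriv η t := by
    rw [← integral_neg]
    refine setIntegral_congr_fun measurableSet_Ioc fun t ht => ?_
    have ht' := Ioc_subset_Icc_self ht
    simp only [(hdloc t ht').deriv_eq, (hdloc t ht').eq_of_nhds, (hloc t ht').eq_of_nhds,
      (hasDerivAt_adjointSolutionDeriv hαβ (hη.of_le (by simp)) t).deriv]
    ring
  have hsource : ∫ t in Ioc 0 B, N t * ζ t = ∫ t in Ioc 0 B, N t * adjointSolution α β B η t :=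
    setIntegral_congr_fun measurableSet_Ioc fun t ht => by
      simp only [(hloc t (Ioc_subset_Icc_self ht)).eq_of_nhds]
  have h0 : (0 : ℝ) ∈ Icc 0 B := left_mem_Icc.2 hB
  have hweak := h.integral_mul_operator ζ hζ hζc hζB
  rw [hoperator, hsource, h.integral_mul_deriv η hη hηc hηB, (hloc 0 h0).eq_of_nhds,
    (hdloc 0 h0).eq_of_nhds] at hweak
  linarith

theorem ae_eq (h : SolvesWeakODE B (-(α + β)) (α * β) I J V f N) (hαβ : α ≠ β) (hB : 0 ≤ B) :
    ∀ᵐ t, t ∈ Ioo 0 B → f t =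
      (α * expPrimitive α (J - β * I) N t - β * expPrimitive β (J - α * I) N t) / (α - β) := by
  set Y : ℝ → ℝ := fun t =>
    (α * expPrimitive α (J - β * I) N t - β * expPrimitive β (J - α * I) N t) / (α - β)
  have hYc : ContinuousOn Y (Icc 0 B) := by
    have hα := continuousOn_expPrimitive (α := α) (J := J - β * I) hB h.integrableOn_source
    have hβ := continuousOn_expPrimitive (α := β) (J := J - α * I) hB h.integrableOn_source
    fun_prop
  have hYi : IntegrableOn Y (Ioc 0 B) := hYc.integrableOn_Icc.mono_set Ioc_subset_Icc_self
  have hsub : ∀ᵐ t, t ∈ Ioo 0 B → f t - Y t = 0 := by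
    refine isOpen_Ioo.ae_eq_zero_of_integral_contDiff_smul_eq_zero
      (((h.integrableOn_deriv.sub hYi).mono_set Ioo_subset_Ioc_self).locallyIntegrableOn)
      fun η hη hηc hηB => ?_
    have hη0 : ∀ t ∉ Ioo 0 B, η t = 0 := fun t ht =>
      image_eq_zero_of_notMem_tsupport fun ht' => ht (hηB ht')
    have hfη : IntegrableOn (fun t => f t * η t) (Ioc 0 B) :=
      (((integrableOn_Icc_iff_integrableOn_Ioc).2 h.integrableOn_deriv).mul_continuousOn
        hη.continuous.continuousOn isCompact_Icc).mono_set Ioc_subset_Icc_self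
    have hηY : IntegrableOn (fun t => η t * Y t) (Ioc 0 B) :=
      (hη.continuous.continuousOn.mul hYc).integrableOn_Icc.mono_set Ioc_subset_Icc_self
    have hpair : ∫ t in Ioc 0 B, f t * η t = ∫ t in Ioc 0 B, η t * Y t :=
      (h.integral_deriv_mul hαβ hB hη hηc hηB).trans
        (integral_mul_adjointSolution hαβ hB h.integrableOn_source hη (hη0 0 (by simp)))
    rw [← setIntegral_eq_integral_of_forall_compl_eq_zero (s := Ioc 0 B) fun t ht => by
      rw [hη0 t fun h => ht (Ioo_subset_Ioc_self h), zero_smul]]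
    simp only [smul_eq_mul, mul_sub, mul_comm (η _) (f _)]
    rw [integral_sub hfη hηY, hpair, sub_self]
  filter_upwards [hsub] with t ht htB
  exact sub_eq_zero.1 (ht htB)

theorem ae_le_deriv (h : SolvesWeakODE B (-(α + β)) (α * β) I J V f N) (hβ : β ≤ 0) (hα : 0 ≤ α)
    (hβα : β < α) (hI : 0 ≤ I) (hB : 0 ≤ B) :
    ∀ᵐ t, t ∈ Ioo 0 B →
      (α * expPrimitive α J N t - β * expPrimitive β J N t) / (α - β) ≤ f t := by
  filter_upwards [h.ae_eq hβα.ne' hB] with t ht htB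
  have hexp : Real.exp (β * t) ≤ Real.exp (α * t) := by
    have := htB.1.le
    gcongr
  rw [ht htB]
  refine div_le_div_of_nonneg_right ?_ (sub_nonneg.2 hβα.le)
  simp only [expPrimitive, expMass]
  nlinarith [mul_nonneg (mul_nonneg (mul_nonneg hα (neg_nonneg.2 hβ)) hI) (sub_nonneg.2 hexp)]

theorem ae_expPrimitive_le_two_mul_deriv {l : ℝ} (h : SolvesWeakODE B 0 (-l ^ 2) I J V f N)
    (hl : 0 < l) (hI : 0 ≤ I) (hJ : 0 ≤ J) (hN : ∀ s, 0 ≤ N s) (hB : 0 ≤ B) :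
    ∀ᵐ t, t ∈ Ioo 0 B → expPrimitive l J N t ≤ 2 * f t := by
  have h' : SolvesWeakODE B (-(l + -l)) (l * -l) I J V f N := by
    convert h using 1 <;> ring
  filter_upwards [h'.ae_le_deriv (by linarith) hl.le (by linarith) hI hB] with t ht htB
  have hmain : (l * expPrimitive l J N t - -l * expPrimitive (-l) J N t) / (l - -l) =
      (expPrimitive l J N t + expPrimitive (-l) J N t) / 2 := by
    field_simp
    ring
  linarith [ht htB, expPrimitive_nonneg (α := -l) hJ hN htB.1.le]

theorem ae_expPrimitive_le_deriv {b l m : ℝ} (h : SolvesWeakODE B b (m ^ 2 - l ^ 2) I J V f N)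
    (hm : |m| < l) (hI : 0 ≤ I) (hJ : 0 ≤ J) (hN : ∀ s, 0 ≤ N s) (hB : 0 ≤ B) :
    ∀ᵐ t, t ∈ Ioo 0 B → expPrimitive (-(|b| + l)) 0 N t ≤ f t := by
  set D := √(b ^ 2 + 4 * (l ^ 2 - m ^ 2))
  have hml : m ^ 2 < l ^ 2 := sq_lt_sq' (by linarith [neg_abs_le m]) (by linarith [le_abs_self m])
  have hDsq : D ^ 2 = b ^ 2 + 4 * (l ^ 2 - m ^ 2) := Real.sq_sqrt (by nlinarith [sq_nonneg b])
  have hbD : |b| < D := Real.lt_sqrt_of_sq_lt (by rw [sq_abs]; linarith)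
  have hDb : D ≤ |b| + 2 * l := Real.sqrt_le_iff.2
    ⟨by linarith [abs_nonneg b, abs_nonneg m],
      by nlinarith [sq_abs b, abs_nonneg b, abs_nonneg m, sq_nonneg m]⟩
  set α := (-b + D) / 2 with hα
  set β := (-b - D) / 2 with hβ
  have hβ0 : β ≤ 0 := by linarith [neg_abs_le b]
  have hα0 : 0 ≤ α := by linarith [le_abs_self b]
  have hβα : β < α := by linarith [abs_nonneg b]
  have h' : SolvesWeakODE B (-(α + β)) (α * β) I J V f N := by
    convert h using 1
    · ring
    · linear_combination (-1 / 4) * hDsq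
  filter_upwards [h'.ae_le_deriv hβ0 hα0 hβα hI hB] with t ht htB
  have htB' : t ∈ Icc 0 B := Ioo_subset_Icc_self htB
  have hweight : expPrimitive β J N t ≤
      (α * expPrimitive α J N t - β * expPrimitive β J N t) / (α - β) := by
    rw [le_div_iff₀ (sub_pos.2 hβα)]
    nlinarith [expPrimitive_mono hβα.le hJ le_rfl hN h.integrableOn_source htB']
  calc expPrimitive (-(|b| + l)) 0 N t ≤ expPrimitive β J N t :=
        expPrimitive_mono (by linarith [le_abs_self b]) le_rfl hJ hN h.integrableOn_source htB'
    _ ≤ f t := hweight.trans (ht htB)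

end SolvesWeakODE

end WeakODE

section Laplacian

variable {n : ℕ} {a : Fin n} {l : ℝ}

theorem fderiv_planeExp :
    fderiv ℝ (planeExp a l) =
      fun x => planeExp a l x • l • (EuclideanSpace.proj a : Space n →L[ℝ] ℝ) :=
  funext fun _ => HasFDerivAt.fderiv
    (((EuclideanSpace.proj a : Space n →L[ℝ] ℝ).hasFDerivAt.const_mul l).exp)

theorem laplacian_planeExp (x : Space n) :
    Laplacian.laplacian (planeExp a l) x = l ^ 2 * planeExp a l x := by
  have hdiff : DifferentiableAt ℝ (planeExp a l) x :=
    (contDiff_planeExp (k := 1)).differentiable one_ne_zero x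
  have hsecond (i : Fin n) : iteratedFDeriv ℝ 2 (planeExp a l) x
      ![EuclideanSpace.basisFun (Fin n) ℝ i, EuclideanSpace.basisFun (Fin n) ℝ i] =
      if i = a then l ^ 2 * planeExp a l x else 0 := by
    rw [iteratedFDeriv_two_apply, fderiv_planeExp,
      (hdiff.hasFDerivAt.smul_const (l • (EuclideanSpace.proj a : Space n →L[ℝ] ℝ))).fderiv,
      fderiv_planeExp]
    obtain rfl | hi := eq_or_ne i a
    · simp only [EuclideanSpace.basisFun_apply, Matrix.cons_val_zero,
        ContinuousLinearMap.smulRight_apply, smul_apply, PiLp.proj_apply, PiLp.single_eq_same,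
        smul_eq_mul, mul_one, Matrix.cons_val_one, Matrix.cons_val_fin_one, if_true]
      ring
    · simp [hi, hi.symm]
  rw [InnerProductSpace.laplacian_eq_iteratedFDeriv_orthonormalBasis _
    (EuclideanSpace.basisFun (Fin n) ℝ)]
  simp only [hsecond, Finset.sum_ite_eq', Finset.mem_univ, if_true]

end Laplacian

section Cone

variable {n : ℕ} {a : Fin n} {l r R B : ℝ} {T : EReal} {w wt g : ℝ × Space n → ℝ}

/-- The integral of `g(t, ·) e^{l x_a}` over the ball of radius `r`, the weighted mean of
the solution in a section of the cone, for which an ordinary differential equation is derived. -/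
def expMean (a : Fin n) (l r : ℝ) (g : ℝ × Space n → ℝ) (t : ℝ) : ℝ :=
  ∫ x in Metric.closedBall (0 : Space n) r, g (t, x) * planeExp a l x

/-- The exponential moment of a Cauchy datum, the initial value of its weighted mean. -/
def expMoment (a : Fin n) (l : ℝ) (f : Space n → ℝ) : ℝ := ∫ x, f x * planeExp a l x

theorem expMean_nonneg (hg : ∀ z, 0 ≤ g z) (t : ℝ) : 0 ≤ expMean a l r g t :=
  integral_nonneg fun _ => mul_nonneg (hg _) (planeExp_pos _).le

theorem measurableSet_slab : MeasurableSet (slab n T) :=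
  (measurableSet_le measurable_const measurable_fst).inter
    (measurableSet_lt (measurable_coe_real_ereal.comp measurable_fst) measurable_const)

theorem Icc_prod_subset_slab (hBT : (B : EReal) < T) (K : Set (Space n)) :
    Icc 0 B ×ˢ K ⊆ slab n T := fun _ hz =>
  ⟨hz.1.1, (EReal.coe_le_coe_iff.2 hz.1.2).trans_lt hBT⟩

theorem SupportedInCone.eq_zero (hw : SupportedInCone n R T w) {z : ℝ × Space n}
    (hz : z ∈ slab n T) (hx : R + z.1 < ‖z.2‖) : w z = 0 :=
  image_eq_zero_of_notMem_tsupport (f := fun x => w (z.1, x)) fun h =>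
    hx.not_ge (mem_closedBall_zero_iff.1 (hw z.1 hz.1 hz.2 h))

theorem timeDeriv_eq_zero_of_notMem_tsupport {φ : ℝ × Space n → ℝ} {z : ℝ × Space n}
    (hz : z ∉ tsupport φ) : timeDeriv φ z = 0 := by
  have hφ : φ =ᶠ[nhds z] 0 := notMem_tsupport_iff_eventuallyEq.1 hz
  have hslice : (fun s : ℝ => φ (s, z.2)) =ᶠ[nhds z.1] fun _ => 0 :=
    ((by fun_prop : Continuous fun s : ℝ => (s, z.2)).continuousAt (x := z.1)).eventually hφ
  rw [timeDeriv, hslice.deriv_eq, deriv_const]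

theorem HasWeakTimeDeriv.ae_eq_zero (hd : HasWeakTimeDeriv n T w wt)
    (hw : SupportedInCone n R T w) (hBT : (B : EReal) < T) :
    ∀ᵐ z : ℝ × Space n, z.1 ∈ Ioo 0 B → R + z.1 < ‖z.2‖ → wt z = 0 := by
  set O : Set (ℝ × Space n) := {z | z.1 ∈ Ioo 0 B ∧ R + z.1 < ‖z.2‖}
  have hOo : IsOpen O := (isOpen_Ioo.preimage continuous_fst).inter
    (isOpen_lt (continuous_const.add continuous_fst) continuous_snd.norm)
  have hOs : O ⊆ slab n T := fun z hz =>
    ⟨hz.1.1.le, (EReal.coe_lt_coe_iff.2 hz.1.2).trans hBT⟩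
  suffices ∀ᵐ z, z ∈ O → wt z = 0 from this.mono fun z hz h1 h2 => hz ⟨h1, h2⟩
  refine hOo.ae_eq_zero_of_integral_contDiff_smul_eq_zero
    (hd.locallyIntegrable.mono_set hOs) fun φ hφ hφc hφs => ?_
  have hzero : ∫ z in slab n T, w z * timeDeriv φ z = 0 :=
    setIntegral_eq_zero_of_forall_eq_zero fun z hz => by
      by_cases hzφ : z ∈ tsupport φ
      · rw [hw.eq_zero hz (hφs hzφ).2, zero_mul]
      · rw [timeDeriv_eq_zero_of_notMem_tsupport hzφ, mul_zero]
  rw [hd.integral_eq φ ⟨hφ, hφc, fun z hz => (hOs (hφs hz)).2⟩ fun z hz => (hφs hz).1.1,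
    neg_eq_zero] at hzero
  rw [← setIntegral_eq_integral_of_forall_compl_eq_zero (s := slab n T) fun z hz => by
    rw [image_eq_zero_of_notMem_tsupport fun h => hz (hOs (hφs h)), zero_smul]]
  simpa only [smul_eq_mul, mul_comm (φ _)] using hzero

/-- `g` is integrable on the cylinder `[0, B] × B_{R + B}` and vanishes a.e. outside the cone
`‖x‖ ≤ R + t`; only the values of `g` for times in `[0, B]` matter. -/
structure IntegrableInCone (R B : ℝ) (g : ℝ × Space n → ℝ) : Prop where
  integrableOn : IntegrableOn g (Icc 0 B ×ˢ Metric.closedBall (0 : Space n) (R + B))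
  ae_eq_zero : ∀ᵐ z : ℝ × Space n, z.1 ∈ Ioo 0 B → R + z.1 < ‖z.2‖ → g z = 0

theorem integrableInCone_of_locallyIntegrableOn (hg : LocallyIntegrableOn g (slab n T))
    (hBT : (B : EReal) < T)
    (hg0 : ∀ᵐ z : ℝ × Space n, z.1 ∈ Ioo 0 B → R + z.1 < ‖z.2‖ → g z = 0) :
    IntegrableInCone R B g :=
  ⟨hg.integrableOn_compact_subset (Icc_prod_subset_slab hBT _)
    (isCompact_Icc.prod (isCompact_closedBall _ _)), hg0⟩

namespace IntegrableInCone

theorem integrable_mul_planeExp (hg : IntegrableInCone R B g) {ξ : ℝ → ℝ} (hξ : Continuous ξ) :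
    Integrable (fun z => g z * (ξ z.1 * planeExp a l z.2)) ((volume.restrict (Ioc 0 B)).prod
      (volume.restrict (Metric.closedBall (0 : Space n) (R + B)))) := by
  rw [Measure.prod_restrict, ← Measure.volume_eq_prod]
  exact (hg.integrableOn.mul_continuousOn (by fun_prop)
    (isCompact_Icc.prod (isCompact_closedBall _ _))).mono_set
    (prod_mono Ioc_subset_Icc_self subset_rfl)

theorem integrableOn_expMean (hg : IntegrableInCone R B g) :
    IntegrableOn (expMean a l (R + B) g) (Ioc 0 B) := by
  have h := (hg.integrable_mul_planeExp (a := a) (l := l)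
    (ξ := fun _ => 1) continuous_const).integral_prod_left
  simp only [one_mul] at h
  exact h

theorem setIntegral_slab_eq (hg : IntegrableInCone R B g) (hBT : (B : EReal) < T)
    {θ : ℝ × Space n → ℝ} {ξ : ℝ → ℝ} (hξ : Continuous ξ) (hθ : ∀ z, B ≤ z.1 → θ z = 0)
    (hθξ : ∀ z, z.2 ∈ Metric.closedBall (0 : Space n) (R + B) →
      θ z = ξ z.1 * planeExp a l z.2) :
    ∫ z in slab n T, g z * θ z = ∫ t in Ioc 0 B, expMean a l (R + B) g t * ξ t := by
  set Q := Ioc 0 B ×ˢ Metric.closedBall (0 : Space n) (R + B)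
  have hQm : MeasurableSet Q := measurableSet_Ioc.prod Metric.isClosed_closedBall.measurableSet
  have hQs : Q ⊆ slab n T :=
    (prod_mono Ioc_subset_Icc_self subset_rfl).trans (Icc_prod_subset_slab hBT _)
  have htime : ∀ᵐ z : ℝ × Space n, z.1 ≠ 0 :=
    Measure.quasiMeasurePreserving_fst.ae (Measure.ae_ne volume (0 : ℝ))
  have hout : ∀ᵐ z : ℝ × Space n, z ∈ slab n T \ Q → g z * θ z = 0 := by
    filter_upwards [htime, hg.ae_eq_zero] with z hz0 hz hzd
    rcases le_or_gt B z.1 with h | h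
    · rw [hθ z h, mul_zero]
    · have hpos : 0 < z.1 := hzd.1.1.lt_of_ne' hz0
      have hnorm : R + B < ‖z.2‖ := not_le.1 fun hle =>
        hzd.2 ⟨⟨hpos, h.le⟩, mem_closedBall_zero_iff.2 hle⟩
      rw [hz ⟨hpos, h⟩ (by linarith), zero_mul]
  have hmul := hg.integrable_mul_planeExp (a := a) (l := l) hξ
  calc ∫ z in slab n T, g z * θ z = ∫ z in Q, g z * θ z :=
        setIntegral_eq_of_subset_of_ae_sdiff_eq_zero measurableSet_slab.nullMeasurableSet hQs hout
    _ = ∫ z in Q, g z * (ξ z.1 * planeExp a l z.2) :=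
        setIntegral_congr_fun hQm fun z hz => by simp only [hθξ z hz.2]
    _ = ∫ t in Ioc 0 B, ∫ x in Metric.closedBall (0 : Space n) (R + B),
          g (t, x) * (ξ t * planeExp a l x) := by
        rw [Measure.volume_eq_prod, ← Measure.prod_restrict, integral_prod _ hmul]
    _ = ∫ t in Ioc 0 B, expMean a l (R + B) g t * ξ t := by
        simp only [expMean, ← integral_mul_const, mul_assoc, mul_comm (ξ _)]

end IntegrableInCone

end Cone

section CutoffExp

variable {n : ℕ} {a : Fin n} {l : ℝ} {χ : ContDiffBump (0 : Space n)} {ζ : ℝ → ℝ}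
  {z : ℝ × Space n}

/-- The test function `ζ(t) χ(x) e^{l x_a}`. -/
def cutoffExp (a : Fin n) (l : ℝ) (χ : ContDiffBump (0 : Space n)) (ζ : ℝ → ℝ)
    (z : ℝ × Space n) : ℝ :=
  ζ z.1 * (χ z.2 * planeExp a l z.2)

theorem timeDeriv_cutoffExp (hζ : Differentiable ℝ ζ) :
    timeDeriv (cutoffExp a l χ ζ) = cutoffExp a l χ (deriv ζ) :=
  funext fun z => ((hζ z.1).hasDerivAt.mul_const (χ z.2 * planeExp a l z.2)).deriv

theorem cutoffExp_eq (hz : z.2 ∈ Metric.closedBall (0 : Space n) χ.rIn) :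
    cutoffExp a l χ ζ z = ζ z.1 * planeExp a l z.2 := by
  rw [cutoffExp, χ.one_of_mem_closedBall hz, one_mul]

theorem cutoffExp_eq_zero (hz : ζ z.1 = 0) : cutoffExp a l χ ζ z = 0 := by
  rw [cutoffExp, hz, zero_mul]

theorem spaceLaplacian_cutoffExp (hz : z.2 ∈ Metric.ball (0 : Space n) χ.rIn) :
    spaceLaplacian (cutoffExp a l χ ζ) z = l ^ 2 * (ζ z.1 * planeExp a l z.2) := by
  have hχ : (fun y => cutoffExp a l χ ζ (z.1, y)) =ᶠ[nhds z.2] ζ z.1 • planeExp a l := by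
    filter_upwards [χ.eventuallyEq_one_of_mem_ball hz] with y hy
    rw [cutoffExp, hy, Pi.one_apply, one_mul, Pi.smul_apply, smul_eq_mul]
  rw [spaceLaplacian, (InnerProductSpace.laplacian_congr_nhds hχ).eq_of_nhds,
    InnerProductSpace.laplacian_smul _ contDiff_planeExp.contDiffAt, laplacian_planeExp,
    smul_eq_mul, mul_left_comm]

theorem spaceLaplacian_cutoffExp_eq_zero (hz : ζ z.1 = 0) :
    spaceLaplacian (cutoffExp a l χ ζ) z = 0 := by
  simp [spaceLaplacian, cutoffExp, hz]

theorem tsupport_cutoffExp_subset :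
    tsupport (cutoffExp a l χ ζ) ⊆ tsupport ζ ×ˢ Metric.closedBall (0 : Space n) χ.rOut := by
  refine closure_minimal (fun z hz => ⟨subset_tsupport _ fun h => hz ?_, ?_⟩)
    ((isClosed_tsupport ζ).prod Metric.isClosed_closedBall)
  · exact cutoffExp_eq_zero h
  · rw [← χ.tsupport_eq]
    exact subset_tsupport _ fun h => hz (by rw [cutoffExp, h, zero_mul, mul_zero])

theorem isTestFunction_cutoffExp {T : EReal} {B : ℝ} (hBT : (B : EReal) < T)
    (hζ : ContDiff ℝ ∞ ζ) (hζc : HasCompactSupport ζ) (hζs : tsupport ζ ⊆ Iio B) :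
    IsTestFunction n T (cutoffExp a l χ ζ) where
  smooth := (hζ.comp contDiff_fst).mul
    ((χ.contDiff.comp contDiff_snd).mul (contDiff_planeExp.comp contDiff_snd))
  compact := (hζc.isCompact.prod (isCompact_closedBall (0 : Space n) χ.rOut)).of_isClosed_subset
    (isClosed_tsupport _) tsupport_cutoffExp_subset
  supp := fun _ hz => (EReal.coe_lt_coe_iff.2 (hζs (tsupport_cutoffExp_subset hz).1)).trans hBT

end CutoffExp

section Reduction

variable {n : ℕ} {a : Fin n} {l R B b c : ℝ} {T : EReal} {w wt F : ℝ × Space n → ℝ}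
  {f g : Space n → ℝ} {χ : ContDiffBump (0 : Space n)} {ζ : ℝ → ℝ}

theorem eq_zero_of_tsupport_subset_Iio (hζ : tsupport ζ ⊆ Iio B) {t : ℝ} (ht : B ≤ t) :
    ζ t = 0 :=
  image_eq_zero_of_notMem_tsupport fun h => ht.not_gt (hζ h)

theorem integrable_mul_planeExp (hf : Continuous f) (hfs : tsupport f ⊆ Metric.closedBall 0 R) :
    Integrable fun x => f x * planeExp a l x :=
  (hf.mul continuous_planeExp).integrable_of_hasCompactSupport (HasCompactSupport.mul_right
    ((isCompact_closedBall _ _).of_isClosed_subset (isClosed_tsupport f) hfs))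

theorem mul_cutoffExp (hfs : tsupport f ⊆ Metric.closedBall 0 R) (hχ : R ≤ χ.rIn) (t : ℝ)
    (x : Space n) : f x * cutoffExp a l χ ζ (t, x) = ζ t * (f x * planeExp a l x) := by
  by_cases hx : x ∈ tsupport f
  · rw [cutoffExp_eq (Metric.closedBall_subset_closedBall hχ (hfs hx)), mul_left_comm]
  · rw [image_eq_zero_of_notMem_tsupport hx, zero_mul, zero_mul, mul_zero]

theorem IntegrableInCone.setIntegral_slab_mul_cutoffExp (hw : IntegrableInCone R B w)
    (hBT : (B : EReal) < T) (hχ : R + B ≤ χ.rIn) (hζ : Continuous ζ)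
    (hζB : tsupport ζ ⊆ Iio B) :
    ∫ z in slab n T, w z * cutoffExp a l χ ζ z =
      ∫ t in Ioc 0 B, expMean a l (R + B) w t * ζ t :=
  hw.setIntegral_slab_eq hBT hζ
    (fun _ hz => cutoffExp_eq_zero (eq_zero_of_tsupport_subset_Iio hζB hz))
    fun _ hz => cutoffExp_eq (Metric.closedBall_subset_closedBall hχ hz)

theorem HasWeakTimeDeriv.integral_expMean_mul_deriv (hd : HasWeakTimeDeriv n T w wt)
    (hw : IntegrableInCone R B w) (hwt : IntegrableInCone R B wt) (hBT : (B : EReal) < T)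
    (hχ : R + B ≤ χ.rIn) (hζ : ContDiff ℝ ∞ ζ) (hζc : HasCompactSupport ζ)
    (hζs : tsupport ζ ⊆ Ioo 0 B) :
    ∫ t in Ioc 0 B, expMean a l (R + B) w t * deriv ζ t =
      -∫ t in Ioc 0 B, expMean a l (R + B) wt t * ζ t := by
  have hζB : tsupport ζ ⊆ Iio B := hζs.trans Ioo_subset_Iio_self
  have h := hd.integral_eq (cutoffExp a l χ ζ) (isTestFunction_cutoffExp hBT hζ hζc hζB)
    fun z hz => (hζs (tsupport_cutoffExp_subset hz).1).1
  rwa [timeDeriv_cutoffExp (hζ.differentiable (by simp)),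
    hw.setIntegral_slab_mul_cutoffExp hBT hχ (hζ.continuous_deriv (by simp))
      (tsupport_deriv_subset.trans hζB),
    hwt.setIntegral_slab_mul_cutoffExp hBT hχ hζ.continuous hζB] at h

theorem integral_data_mul_cutoffExp (hf : Continuous f) (hg : Continuous g)
    (hfs : tsupport f ⊆ Metric.closedBall 0 R) (hgs : tsupport g ⊆ Metric.closedBall 0 R)
    (hχ : R ≤ χ.rIn) (hζ : Differentiable ℝ ζ) :
    ∫ x, ((g x + b * f x) * cutoffExp a l χ ζ (0, x) -
        f x * timeDeriv (cutoffExp a l χ ζ) (0, x)) =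
      (expMoment a l g + b * expMoment a l f) * ζ 0 - expMoment a l f * deriv ζ 0 := by
  have hpt (x : Space n) : (g x + b * f x) * cutoffExp a l χ ζ (0, x) -
      f x * timeDeriv (cutoffExp a l χ ζ) (0, x) =
      ζ 0 * (g x * planeExp a l x) + (b * ζ 0 - deriv ζ 0) * (f x * planeExp a l x) := by
    rw [timeDeriv_cutoffExp hζ, mul_cutoffExp hfs hχ, add_mul, mul_assoc b, mul_cutoffExp hfs hχ,
      mul_cutoffExp hgs hχ]
    ring
  simp only [hpt, expMoment]
  rw [integral_add ((integrable_mul_planeExp hg hgs).const_mul _)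
    ((integrable_mul_planeExp hf hfs).const_mul _), integral_const_mul, integral_const_mul]
  ring

theorem IntegrableInCone.setIntegral_slab_mul_operator (hw : IntegrableInCone R B w)
    (hBT : (B : EReal) < T) (hχ : R + B < χ.rIn) (hζ : ContDiff ℝ ∞ ζ)
    (hζB : tsupport ζ ⊆ Iio B) :
    ∫ z in slab n T, w z * (timeDeriv (timeDeriv (cutoffExp a l χ ζ)) z -
        spaceLaplacian (cutoffExp a l χ ζ) z - b * timeDeriv (cutoffExp a l χ ζ) z +
        c * cutoffExp a l χ ζ z) =
      ∫ t in Ioc 0 B, expMean a l (R + B) w t *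
        (deriv (deriv ζ) t - b * deriv ζ t + (c - l ^ 2) * ζ t) := by
  have hζ' : ContDiff ℝ ∞ (deriv ζ) := (contDiff_infty_iff_deriv.1 hζ).2
  have hζ'' : Continuous (deriv (deriv ζ)) := hζ'.continuous_deriv (by simp)
  have hζB' : tsupport (deriv ζ) ⊆ Iio B := tsupport_deriv_subset.trans hζB
  rw [timeDeriv_cutoffExp (hζ.differentiable (by simp)),
    timeDeriv_cutoffExp (hζ'.differentiable (by simp))]
  refine hw.setIntegral_slab_eq (ξ := fun t => deriv (deriv ζ) t - b * deriv ζ t +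
    (c - l ^ 2) * ζ t) hBT ?_ (fun z hz => ?_) fun z hz => ?_
  · exact (hζ''.sub (hζ'.continuous.const_mul b)).add (hζ.continuous.const_mul _)
  · have h0 : ζ z.1 = 0 := eq_zero_of_tsupport_subset_Iio hζB hz
    have h1 : deriv ζ z.1 = 0 := eq_zero_of_tsupport_subset_Iio hζB' hz
    have h2 : deriv (deriv ζ) z.1 = 0 :=
      eq_zero_of_tsupport_subset_Iio (tsupport_deriv_subset.trans hζB') hz
    rw [cutoffExp_eq_zero h0, cutoffExp_eq_zero h1, cutoffExp_eq_zero h2,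
      spaceLaplacian_cutoffExp_eq_zero h0]
    ring
  · have hball : z.2 ∈ Metric.ball (0 : Space n) χ.rIn := Metric.closedBall_subset_ball hχ hz
    have hball' := Metric.ball_subset_closedBall hball
    rw [cutoffExp_eq hball', cutoffExp_eq hball', cutoffExp_eq hball',
      spaceLaplacian_cutoffExp hball]
    ring

/-- Since `Δ e^{l x_a} = l² e^{l x_a}`, testing the equation with `ζ(t) e^{l x_a}` reduces it to an
ordinary differential equation; a cut-off far outside the cone makes this admissible. -/
theorem SolvesWeakly.solvesWeakODE_expMean (hsol : SolvesWeakly n T b c F f g w)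
    (hd : HasWeakTimeDeriv n T w wt) (hw : IntegrableInCone R B w)
    (hwt : IntegrableInCone R B wt) (hF : IntegrableInCone R B F) (hBT : (B : EReal) < T)
    (hR : 0 ≤ R) (hB : 0 ≤ B) (hf : Continuous f) (hg : Continuous g)
    (hfs : tsupport f ⊆ Metric.closedBall 0 R) (hgs : tsupport g ⊆ Metric.closedBall 0 R) :
    SolvesWeakODE B b (c - l ^ 2) (expMoment a l f) (expMoment a l g)
      (expMean a l (R + B) w) (expMean a l (R + B) wt) (expMean a l (R + B) F) := by
  let χ : ContDiffBump (0 : Space n) := ⟨R + B + 1, R + B + 2, by linarith, by linarith⟩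
  have hχ : R + B < χ.rIn := by change R + B < R + B + 1; linarith
  refine ⟨hwt.integrableOn_expMean, hF.integrableOn_expMean, fun η hη hηc hηs =>
    hd.integral_expMean_mul_deriv hw hwt hBT hχ.le hη hηc hηs, fun ζ hζ hζc hζB => ?_⟩
  have h := hsol (cutoffExp a l χ ζ) (isTestFunction_cutoffExp hBT hζ hζc hζB)
  rwa [hw.setIntegral_slab_mul_operator hBT hχ hζ hζB,
    hF.setIntegral_slab_mul_cutoffExp hBT hχ.le hζ.continuous hζB,
    integral_data_mul_cutoffExp hf hg hfs hgs (by linarith) (hζ.differentiable (by simp))] at h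

end Reduction

section Jensen

theorem rpow_tangent_le {p y s : ℝ} (hp : 1 ≤ p) (hy : 0 ≤ y) (hs : 0 < s) :
    p * s ^ (p - 1) * y - (p - 1) * s ^ p ≤ y ^ p := by
  have hys : 0 ≤ y / s := div_nonneg hy hs.le
  have hbernoulli : 1 + p * (y / s - 1) ≤ (1 + (y / s - 1)) ^ p :=
    one_add_mul_self_le_rpow_one_add (by linarith) hp
  calc p * s ^ (p - 1) * y - (p - 1) * s ^ p
      = s ^ p * (1 + p * (y / s - 1)) := by
        rw [Real.rpow_sub_one hs.ne']
        field_simp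
        ring
    _ ≤ s ^ p * (1 + (y / s - 1)) ^ p := by gcongr
    _ = y ^ p := by
        rw [add_sub_cancel, ← Real.mul_rpow hs.le hys, mul_div_cancel₀ _ hs.ne']

theorem rpow_mul_rpow_le_integral {α : Type*} [MeasurableSpace α] {μ : Measure α} {p y A : ℝ}
    {f φ : α → ℝ} (hp : 1 ≤ p) (hφ0 : ∀ x, 0 ≤ φ x) (hφ : Integrable φ μ)
    (hf : Integrable (fun x => f x * φ x) μ) (hfp : Integrable (fun x => |f x| ^ p * φ x) μ)
    (hy : 0 ≤ y) (hyf : y ≤ ∫ x, f x * φ x ∂μ) (hA : 0 < A) (hφA : ∫ x, φ x ∂μ ≤ A) :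
    y ^ p * A ^ (1 - p) ≤ ∫ x, |f x| ^ p * φ x ∂μ := by
  obtain rfl | hy := hy.eq_or_lt
  · rw [Real.zero_rpow (by linarith), zero_mul]
    exact integral_nonneg fun x => mul_nonneg (by positivity) (hφ0 x)
  set s := y / A
  have hs : 0 < s := div_pos hy hA
  have hyA : y = s * A := (div_mul_cancel₀ y hA.ne').symm
  have hpoint (x : α) : p * s ^ (p - 1) * (f x * φ x) - (p - 1) * s ^ p * φ x ≤
      |f x| ^ p * φ x :=
    calc p * s ^ (p - 1) * (f x * φ x) - (p - 1) * s ^ p * φ x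
        = (p * s ^ (p - 1) * f x - (p - 1) * s ^ p) * φ x := by ring
      _ ≤ (p * s ^ (p - 1) * |f x| - (p - 1) * s ^ p) * φ x := by
          have := hφ0 x
          gcongr
          exact le_abs_self _
      _ ≤ |f x| ^ p * φ x :=
          mul_le_mul_of_nonneg_right (rpow_tangent_le hp (abs_nonneg _) hs) (hφ0 x)
  calc y ^ p * A ^ (1 - p) = p * s ^ (p - 1) * y - (p - 1) * s ^ p * A := by
        rw [hyA, Real.mul_rpow hs.le hA.le, Real.rpow_sub hA, Real.rpow_one,
          Real.rpow_sub_one hs.ne']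
        field_simp
        ring
    _ ≤ p * s ^ (p - 1) * (∫ x, f x * φ x ∂μ) - (p - 1) * s ^ p * ∫ x, φ x ∂μ := by
        have : 0 ≤ (p - 1) * s ^ p := mul_nonneg (by linarith) (by positivity)
        gcongr
    _ = ∫ x, (p * s ^ (p - 1) * (f x * φ x) - (p - 1) * s ^ p * φ x) ∂μ := by
        rw [integral_sub (hf.const_mul _) (hφ.const_mul _), integral_const_mul,
          integral_const_mul]
    _ ≤ ∫ x, |f x| ^ p * φ x ∂μ :=
        integral_mono ((hf.const_mul _).sub (hφ.const_mul _)) hfp hpoint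

namespace IntegrableInCone

variable {n : ℕ} {a : Fin n} {l R B p : ℝ} {g : ℝ × Space n → ℝ}

theorem ae_integrableOn_slice (hg : IntegrableInCone R B g) :
    ∀ᵐ t, t ∈ Ioo 0 B →
      IntegrableOn (fun x => g (t, x) * planeExp a l x) (Metric.closedBall 0 (R + t)) := by
  have h := (hg.integrable_mul_planeExp (a := a) (l := l)
    (ξ := fun _ => 1) continuous_const).prod_right_ae
  rw [ae_restrict_iff' measurableSet_Ioc] at h
  filter_upwards [h] with t ht htB
  have hslice := ht (Ioo_subset_Ioc_self htB)
  simp only [one_mul] at hslice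
  exact IntegrableOn.mono_set hslice (Metric.closedBall_subset_closedBall (by linarith [htB.2]))

theorem ae_expMean_eq (hg : IntegrableInCone R B g) :
    ∀ᵐ t, t ∈ Ioo 0 B → expMean a l (R + B) g t = expMean a l (R + t) g t := by
  have h0 : ∀ᵐ t : ℝ, ∀ᵐ x : Space n, t ∈ Ioo 0 B → R + t < ‖x‖ → g (t, x) = 0 :=
    Measure.ae_ae_of_ae_prod hg.ae_eq_zero
  filter_upwards [h0] with t ht htB
  refine setIntegral_eq_of_subset_of_ae_sdiff_eq_zero
    Metric.isClosed_closedBall.measurableSet.nullMeasurableSet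
    (Metric.closedBall_subset_closedBall (by linarith [htB.2])) ?_
  filter_upwards [ht] with x hx hxd
  rw [hx htB (not_le.1 fun h => hxd.2 (mem_closedBall_zero_iff.2 h)), zero_mul]

theorem ae_rpow_mul_rpow_le_expMean (hg : IntegrableInCone R B g)
    (hgp : IntegrableInCone R B fun z => |g z| ^ p) (hp : 1 ≤ p) :
    ∀ᵐ t, t ∈ Ioo 0 B → ∀ y A : ℝ, 0 ≤ y → y ≤ expMean a l (R + B) g t → 0 < A →
      ∫ x in Metric.closedBall (0 : Space n) (R + t), planeExp a l x ≤ A →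
      y ^ p * A ^ (1 - p) ≤ expMean a l (R + B) (fun z => |g z| ^ p) t := by
  filter_upwards [hg.ae_integrableOn_slice (a := a) (l := l),
    hgp.ae_integrableOn_slice (a := a) (l := l), hg.ae_expMean_eq (a := a) (l := l),
    hgp.ae_expMean_eq (a := a) (l := l)] with t hint hintp heq heqp htB y A hy hyg hA hA'
  rw [heq htB] at hyg
  rw [heqp htB]
  exact rpow_mul_rpow_le_integral hp (fun x => (planeExp_pos x).le)
    (continuous_planeExp.continuousOn.integrableOn_compact (isCompact_closedBall _ _))
    (hint htB) (hintp htB) hy hyg hA hA'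

end IntegrableInCone

end Jensen

section Iteration

variable {p q l γ R ν c d J B : ℝ} {M N : ℝ → ℝ}

theorem expMass_add_integral_le {α s t : ℝ} {g : ℝ → ℝ} (hN : IntegrableOn N (Ioc 0 B))
    (hs : 0 ≤ s) (hst : s ≤ t) (ht : t ≤ B) (hg : IntervalIntegrable g volume s t)
    (hgN : ∀ᵐ r, r ∈ Ioo s t → g r ≤ Real.exp (-α * r) * N r) :
    expMass α J N s + ∫ r in s..t, g r ≤ expMass α J N t := by
  have h0s := intervalIntegrable_exp_mul (α := α) hN ⟨hs, hst.trans ht⟩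
  have h0t := intervalIntegrable_exp_mul (α := α) hN ⟨hs.trans hst, ht⟩
  have hle : ∫ r in s..t, g r ≤ ∫ r in s..t, Real.exp (-α * r) * N r := by
    refine intervalIntegral.integral_mono_ae_restrict hst hg (h0s.symm.trans h0t) ?_
    rwa [Filter.EventuallyLE, ← restrict_Ioo_eq_restrict_Icc, ae_restrict_iff' measurableSet_Ioo]
  have hadd := intervalIntegral.integral_add_adjacent_intervals h0s (h0s.symm.trans h0t)
  rw [expMass, expMass, ← hadd]
  linarith

theorem expMass_mono {α s t : ℝ} (hN0 : ∀ r, 0 ≤ N r) (hN : IntegrableOn N (Ioc 0 B))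
    (hs : 0 ≤ s) (hst : s ≤ t) (ht : t ≤ B) : expMass α J N s ≤ expMass α J N t := by
  simpa using expMass_add_integral_le (α := α) (J := J) (g := fun _ => 0) hN hs hst ht (by simp)
    (Filter.Eventually.of_forall fun r _ => mul_nonneg (Real.exp_pos (-α * r)).le (hN0 r))

/-- A source that is large only during the last `τ` units of time already makes the primitive
large, up to the factor `e^{-(γ+l)}` lost through damping. -/
theorem mul_exp_le_expPrimitive_neg {k t τ : ℝ} (hM0 : ∀ s, 0 ≤ M s)
    (hM : IntegrableOn M (Ioc 0 B)) (hγl : 0 ≤ γ + l) (hk : 0 ≤ k) (hτ : 0 ≤ τ) (hτ1 : τ ≤ 1)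
    (hτt : τ ≤ t) (ht : t ≤ B) (hkM : ∀ᵐ s, s ∈ Ioo (t - τ) t → k * Real.exp (l * s) ≤ M s) :
    Real.exp (l * t) * (Real.exp (-(γ + l)) * τ * k) ≤ expPrimitive (-γ) 0 M t := by
  have hmass := expMass_add_integral_le (α := -γ) (J := 0) (s := t - τ) (t := t)
    (g := fun _ => k * Real.exp ((γ + l) * (t - τ))) hM (by linarith) (by linarith) ht
    (by simp) <| by
      filter_upwards [hkM] with s hs hsI
      calc k * Real.exp ((γ + l) * (t - τ)) ≤ k * Real.exp ((γ + l) * s) := by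
            have := hsI.1.le
            gcongr
        _ = Real.exp (- -γ * s) * (k * Real.exp (l * s)) := by
            rw [mul_left_comm, ← Real.exp_add]
            ring_nf
        _ ≤ Real.exp (- -γ * s) * M s := by
            gcongr
            exact hs hsI
  have hnonneg := expMass_nonneg (α := -γ) le_rfl hM0 (sub_nonneg.2 hτt)
  rw [intervalIntegral.integral_const, smul_eq_mul, sub_sub_cancel] at hmass
  calc Real.exp (l * t) * (Real.exp (-(γ + l)) * τ * k)
      ≤ Real.exp (l * t) * (Real.exp (-(γ + l) * τ) * τ * k) := by
        gcongr
        nlinarith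
    _ = Real.exp (-γ * t) * (τ * (k * Real.exp ((γ + l) * (t - τ)))) := by
        rw [show -(γ + l) * τ = -γ * t + (γ + l) * (t - τ) - l * t by ring, Real.exp_sub,
          Real.exp_add]
        field_simp
    _ ≤ expPrimitive (-γ) 0 M t := by
        rw [expPrimitive]
        gcongr
        linarith

/-- The weight `e^{lt} (R + t)^ν`, which for `ν = (n - 1) / 2` has the size of the integral of
`e^{l x_a}` over the section of the cone at time `t`. -/
def coneWeight (l R ν t : ℝ) : ℝ := Real.exp (l * t) * (R + t) ^ ν

theorem rpow_mul_coneWeight_rpow {t x : ℝ} (hx : 0 ≤ x) (ht : 0 < R + t) :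
    (Real.exp (l * t) * x) ^ p * coneWeight l R ν t ^ (1 - p) =
      Real.exp (l * t) * (x ^ p * (R + t) ^ (-(ν * (p - 1)))) := by
  have hexp : Real.exp (l * t) ^ p * Real.exp (l * t) ^ (1 - p) = Real.exp (l * t) := by
    rw [← Real.rpow_add (Real.exp_pos _), add_sub_cancel, Real.rpow_one]
  rw [coneWeight, Real.mul_rpow (Real.exp_pos _).le hx,
    Real.mul_rpow (Real.exp_pos _).le (by positivity), ← Real.rpow_mul ht.le, mul_mul_mul_comm,
    hexp]
  ring_nf

theorem rpow_mul_inv_le_rpow_neg {κ T₀ t : ℝ} (hκ0 : 0 ≤ κ) (hκ1 : κ ≤ 1) (hR : 0 ≤ R)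
    (hT₀ : 1 ≤ T₀) (ht : T₀ ≤ t) :
    (1 + R) ^ (-κ) * T₀ ^ (1 - κ) * t⁻¹ ≤ (R + t) ^ (-κ) := by
  have ht1 : 1 ≤ t := hT₀.trans ht
  have ht0 : 0 < t := by linarith
  calc (1 + R) ^ (-κ) * T₀ ^ (1 - κ) * t⁻¹ ≤ (1 + R) ^ (-κ) * t ^ (1 - κ) * t⁻¹ := by
        gcongr
    _ = ((1 + R) * t) ^ (-κ) := by
        rw [Real.mul_rpow (by linarith) ht0.le, mul_assoc, ← Real.rpow_neg_one t,
          ← Real.rpow_add ht0]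
        ring_nf
    _ ≤ (R + t) ^ (-κ) :=
        Real.rpow_le_rpow_of_nonpos (by linarith) (by nlinarith) (by linarith)

/-- The coupled integral inequalities on `(0, B)` obtained for the weighted means `M` of `|∂ₜv|ᵖ`
and `N` of `|∂ₜu|^q`; `γ` is the rate at which the damped equation forgets its source. -/
structure IterationFrame (p q l γ R ν c d J B : ℝ) (M N : ℝ → ℝ) : Prop where
  nonneg_left : ∀ t, 0 ≤ M t
  nonneg_right : ∀ t, 0 ≤ N t
  integrableOn_left : IntegrableOn M (Ioc 0 B)
  integrableOn_right : IntegrableOn N (Ioc 0 B)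
  le_left : ∀ᵐ t, t ∈ Ioo 0 B →
    c * (expPrimitive l J N t ^ p * coneWeight l R ν t ^ (1 - p)) ≤ M t
  le_right : ∀ᵐ t, t ∈ Ioo 0 B →
    d * (expPrimitive (-γ) 0 M t ^ q * coneWeight l R ν t ^ (1 - q)) ≤ N t

namespace IterationFrame

variable {t₀ t₁ τ T₀ t : ℝ}

theorem ae_mul_exp_le_left (h : IterationFrame p q l γ R ν c d J B M N) (hp : 0 ≤ p)
    (hR : 0 < R) (hc : 0 ≤ c) (hJ : 0 ≤ J) (ht₀ : 0 ≤ t₀) :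
    ∀ᵐ s, s ∈ Ioo t₀ B →
      c * (expMass l J N t₀ ^ p * (R + s) ^ (-(ν * (p - 1)))) * Real.exp (l * s) ≤ M s := by
  filter_upwards [h.le_left] with s hs hsI
  have hs0 : 0 < s := ht₀.trans_lt hsI.1
  have hRs : 0 < R + s := by linarith
  have hnonneg := expMass_nonneg (α := l) hJ h.nonneg_right ht₀
  have hmono : expMass l J N t₀ ≤ expMass l J N s :=
    expMass_mono h.nonneg_right h.integrableOn_right ht₀ hsI.1.le hsI.2.le
  calc c * (expMass l J N t₀ ^ p * (R + s) ^ (-(ν * (p - 1)))) * Real.exp (l * s)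
      ≤ c * (expMass l J N s ^ p * (R + s) ^ (-(ν * (p - 1)))) * Real.exp (l * s) := by gcongr
    _ = c * (expPrimitive l J N s ^ p * coneWeight l R ν s ^ (1 - p)) := by
        rw [expPrimitive, rpow_mul_coneWeight_rpow (hnonneg.trans hmono) hRs]
        ring
    _ ≤ M s := hs ⟨hs0, hsI.2⟩

theorem mul_exp_le_expPrimitive (h : IterationFrame p q l γ R ν c d J B M N) (hp : 1 ≤ p)
    (hR : 0 < R) (hν : 0 ≤ ν) (hγl : 0 ≤ γ + l) (hc : 0 ≤ c) (hJ : 0 ≤ J) (ht₀ : 0 ≤ t₀)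
    (hτ : 0 ≤ τ) (hτ1 : τ ≤ 1) (ht : t₀ + τ ≤ t) (htB : t ≤ B) :
    Real.exp (l * t) * (Real.exp (-(γ + l)) * τ *
      (c * (expMass l J N t₀ ^ p * (R + t) ^ (-(ν * (p - 1)))))) ≤ expPrimitive (-γ) 0 M t := by
  have hnonneg := expMass_nonneg (α := l) hJ h.nonneg_right ht₀
  have hRt : 0 < R + t := by linarith
  refine mul_exp_le_expPrimitive_neg h.nonneg_left h.integrableOn_left hγl (by positivity) hτ hτ1
    (by linarith) htB ?_
  filter_upwards [h.ae_mul_exp_le_left (by linarith) hR hc hJ ht₀] with s hs hsI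
  refine le_trans ?_ (hs ⟨by linarith [hsI.1], hsI.2.trans_le htB⟩)
  have hpow : (R + t) ^ (-(ν * (p - 1))) ≤ (R + s) ^ (-(ν * (p - 1))) :=
    Real.rpow_le_rpow_of_nonpos (by linarith [hsI.1]) (by linarith [hsI.2])
      (neg_nonpos.2 (mul_nonneg hν (by linarith)))
  gcongr

theorem ae_rpow_mul_rpow_le_right (h : IterationFrame p q l γ R ν c d J B M N) (hp : 1 ≤ p)
    (hq : 0 ≤ q) (hR : 0 < R) (hν : 0 ≤ ν) (hγl : 0 ≤ γ + l) (hc : 0 ≤ c) (hd : 0 ≤ d)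
    (hJ : 0 ≤ J) (ht₀ : 0 ≤ t₀) (hτ : 0 ≤ τ) (hτ1 : τ ≤ 1) :
    ∀ᵐ t, t ∈ Ioo (t₀ + τ) B →
      d * (c * Real.exp (-(γ + l))) ^ q * (τ ^ q * expMass l J N t₀ ^ (p * q)) *
        (R + t) ^ (-(ν * (p * q - 1))) ≤ Real.exp (-l * t) * N t := by
  filter_upwards [h.le_right] with t ht htI
  have ht0 : 0 < t := by linarith [htI.1]
  have hRt : 0 < R + t := by linarith
  have hnonneg := expMass_nonneg (α := l) hJ h.nonneg_right ht₀
  have hY := h.mul_exp_le_expPrimitive hp hR hν hγl hc hJ ht₀ hτ hτ1 htI.1.le htI.2.le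
  set x := Real.exp (-(γ + l)) * τ * (c * (expMass l J N t₀ ^ p * (R + t) ^ (-(ν * (p - 1)))))
    with hx
  have hx0 : 0 ≤ x := by positivity
  have hxq : x ^ q = (c * Real.exp (-(γ + l))) ^ q * (τ ^ q * expMass l J N t₀ ^ (p * q)) *
      (R + t) ^ (-(ν * (p - 1)) * q) := by
    rw [hx, Real.rpow_mul hnonneg, Real.rpow_mul hRt.le, ← Real.mul_rpow (by positivity)
      (by positivity), ← Real.mul_rpow (by positivity) (by positivity),
      ← Real.mul_rpow (by positivity) (by positivity)]
    ring_nf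
  have hpow : (R + t) ^ (-(ν * (p - 1)) * q) * (R + t) ^ (-(ν * (q - 1))) =
      (R + t) ^ (-(ν * (p * q - 1))) := by
    rw [← Real.rpow_add hRt]
    ring_nf
  calc d * (c * Real.exp (-(γ + l))) ^ q * (τ ^ q * expMass l J N t₀ ^ (p * q)) *
        (R + t) ^ (-(ν * (p * q - 1)))
      = Real.exp (-l * t) * (d * (Real.exp (l * t) * (x ^ q * (R + t) ^ (-(ν * (q - 1)))))) := by
        rw [hxq, ← hpow, mul_left_comm d, ← mul_assoc (Real.exp (-l * t)), ← Real.exp_add,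
          show -l * t + l * t = 0 by ring, Real.exp_zero]
        ring
    _ = Real.exp (-l * t) * (d * ((Real.exp (l * t) * x) ^ q * coneWeight l R ν t ^ (1 - q))) := by
        rw [rpow_mul_coneWeight_rpow hx0 hRt]
    _ ≤ Real.exp (-l * t) *
          (d * (expPrimitive (-γ) 0 M t ^ q * coneWeight l R ν t ^ (1 - q))) := by
        have : 0 ≤ coneWeight l R ν t := by unfold coneWeight; positivity
        gcongr
    _ ≤ Real.exp (-l * t) * N t := by
        gcongr
        exact ht ⟨ht0, htI.2⟩

theorem expMass_add_mul_log_le (h : IterationFrame p q l γ R ν c d J B M N) (hp : 1 ≤ p)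
    (hq : 1 ≤ q) (hR : 0 < R) (hν : 0 ≤ ν) (hκ : ν * (p * q - 1) ≤ 1) (hγl : 0 ≤ γ + l)
    (hc : 0 ≤ c) (hd : 0 ≤ d) (hJ : 0 ≤ J) (hT₀ : 1 ≤ T₀) (ht₀ : T₀ ≤ t₀) (hτ : 0 < τ)
    (hτ1 : τ ≤ 1) (ht₁ : t₀ + τ ≤ t₁) (ht₁B : t₁ ≤ B) :
    expMass l J N t₀ + d * (c * Real.exp (-(γ + l))) ^ q * (1 + R) ^ (-(ν * (p * q - 1))) *
        T₀ ^ (1 - ν * (p * q - 1)) * τ ^ q * expMass l J N t₀ ^ (p * q) *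
          Real.log (t₁ / (t₀ + τ)) ≤ expMass l J N t₁ := by
  have hκ0 : 0 ≤ ν * (p * q - 1) := mul_nonneg hν (by nlinarith)
  have ht₀0 : 0 ≤ t₀ := by linarith
  have hτt : 0 < t₀ + τ := by linarith
  have hnonneg := expMass_nonneg (α := l) hJ h.nonneg_right ht₀0
  set κ := ν * (p * q - 1)
  set k := d * (c * Real.exp (-(γ + l))) ^ q * (τ ^ q * expMass l J N t₀ ^ (p * q)) with hk
  have hk0 : 0 ≤ k := by positivity
  have hmass := expMass_add_integral_le (α := l) (J := J)
    (g := fun t => k * ((1 + R) ^ (-κ) * T₀ ^ (1 - κ)) * t⁻¹) h.integrableOn_right hτt.le ht₁ ht₁B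
    ((intervalIntegrable_inv_iff.2 <| Or.inr <| by
      rw [uIcc_of_le ht₁]
      exact fun h0 => hτt.not_ge h0.1).const_mul _) <| by
      filter_upwards [h.ae_rpow_mul_rpow_le_right hp (by linarith) hR hν hγl hc hd hJ ht₀0 hτ.le
        hτ1] with t ht htI
      refine le_trans ?_ (ht ⟨htI.1, htI.2.trans_le ht₁B⟩)
      rw [mul_assoc]
      exact mul_le_mul_of_nonneg_left
        (rpow_mul_inv_le_rpow_neg hκ0 hκ hR.le hT₀ (by linarith [htI.1])) hk0
  rw [intervalIntegral.integral_const_mul, integral_inv_of_pos hτt (hτt.trans_le ht₁)] at hmass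
  have hmono := expMass_mono (α := l) (J := J) h.nonneg_right h.integrableOn_right ht₀0
    (show t₀ ≤ t₀ + τ by linarith) (ht₁.trans ht₁B)
  calc _ = expMass l J N t₀ +
        k * ((1 + R) ^ (-κ) * T₀ ^ (1 - κ)) * Real.log (t₁ / (t₀ + τ)) := by
        rw [hk]
        ring
    _ ≤ _ := by linarith

theorem lt_mul_exp (h : IterationFrame p q l γ R ν c d J B M N) (hp : 1 ≤ p) (hq : 1 ≤ q)
    (hpq : 1 < p * q) (hR : 0 < R) (hν : 0 ≤ ν) (hκ : ν * (p * q - 1) ≤ 1) (hγl : 0 ≤ γ + l)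
    (hc : 0 < c) (hd : 0 < d) (hJ : 0 < J) (hT₀ : 1 ≤ T₀) {L : ℝ} (hL : 1 ≤ L)
    (hcond : 1 ≤ d * (c * Real.exp (-(γ + l))) ^ q * (1 + R) ^ (-(ν * (p * q - 1))) *
      T₀ ^ (1 - ν * (p * q - 1)) * L * J ^ (p * q - 1)) :
    B < T₀ * Real.exp (2 * L * (1 - sliceRatio (p * q) q)⁻¹) :=
  lt_of_log_slicing hpq (by linarith) (by positivity) hJ hT₀ hL
    (le_expMass h.nonneg_right (by linarith))
    (fun _ _ _ ht₀ hτ hτ1 ht₁ ht₁B => h.expMass_add_mul_log_le hp hq hR hν hκ hγl hc.le hd.le hJ.le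
      hT₀ ht₀ hτ hτ1 ht₁ ht₁B) hcond

end IterationFrame

end Iteration

section Solution

variable {n : ℕ} {a : Fin n} {b m p q l R B ε : ℝ} {T : EReal} {f f₀ f₁ g₀ g₁ : Space n → ℝ}
  {u v w wt : ℝ × Space n → ℝ}

/-- Admissible Cauchy data: continuous, supported in `B_R`, with nonnegative exponential moment.
Only the sign of the moment enters the blow-up argument, not that of the function. -/
structure AdmissibleDatum (a : Fin n) (l R : ℝ) (f : Space n → ℝ) : Prop where
  continuous : Continuous f
  tsupport_subset : tsupport f ⊆ Metric.closedBall 0 R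
  expMoment_nonneg : 0 ≤ expMoment a l f

theorem admissibleDatum_of_nonneg (hf : Continuous f) (hfs : tsupport f ⊆ Metric.closedBall 0 R)
    (hf0 : ∀ x, 0 ≤ f x) : AdmissibleDatum a l R f :=
  ⟨hf, hfs, integral_nonneg fun x => mul_nonneg (hf0 x) (planeExp_pos x).le⟩

theorem expMoment_const_mul (ε : ℝ) (f : Space n → ℝ) :
    expMoment a l (fun x => ε * f x) = ε * expMoment a l f := by
  simp only [expMoment, mul_assoc, integral_const_mul]

theorem expMoment_pos (hf : Continuous f) (hfs : tsupport f ⊆ Metric.closedBall 0 R)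
    (hf0 : ∀ x, 0 ≤ f x) (hne : f ≠ 0) : 0 < expMoment a l f := by
  obtain ⟨x, hx⟩ := Function.ne_iff.1 hne
  exact Continuous.integral_pos_of_hasCompactSupport_nonneg_nonzero (x := x)
    (hf.mul continuous_planeExp) (HasCompactSupport.mul_right
      ((isCompact_closedBall _ _).of_isClosed_subset (isClosed_tsupport f) hfs))
    (fun y => mul_nonneg (hf0 y) (planeExp_pos y).le) (mul_ne_zero hx (planeExp_pos x).ne')

theorem AdmissibleDatum.const_mul (hf : AdmissibleDatum a l R f) (hε : 0 ≤ ε) :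
    AdmissibleDatum a l R fun x => ε * f x where
  continuous := hf.continuous.const_mul ε
  tsupport_subset := (tsupport_mul_subset_right (f := fun _ => ε)).trans hf.tsupport_subset
  expMoment_nonneg := by
    rw [expMoment_const_mul]
    exact mul_nonneg hε hf.expMoment_nonneg

theorem SupportedInCone.integrableInCone (hw : SupportedInCone n R T w)
    (hc : ContinuousOn w (slab n T)) (hBT : (B : EReal) < T) : IntegrableInCone R B w :=
  integrableInCone_of_locallyIntegrableOn (hc.locallyIntegrableOn measurableSet_slab) hBT <|
    Filter.Eventually.of_forall fun _ ht => hw.eq_zero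
      ⟨ht.1.le, (EReal.coe_lt_coe_iff.2 ht.2).trans hBT⟩

theorem HasWeakTimeDeriv.integrableInCone (hd : HasWeakTimeDeriv n T w wt)
    (hw : SupportedInCone n R T w) (hBT : (B : EReal) < T) : IntegrableInCone R B wt :=
  integrableInCone_of_locallyIntegrableOn hd.locallyIntegrable hBT (hd.ae_eq_zero hw hBT)

theorem HasWeakTimeDeriv.integrableInCone_rpow (hd : HasWeakTimeDeriv n T w wt)
    (hw : SupportedInCone n R T w) (hp : p ≠ 0)
    (hloc : LocallyIntegrableOn (fun z => |wt z| ^ p) (slab n T)) (hBT : (B : EReal) < T) :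
    IntegrableInCone R B fun z => |wt z| ^ p :=
  integrableInCone_of_locallyIntegrableOn hloc hBT <| by
    filter_upwards [hd.ae_eq_zero hw hBT] with z hz ht hx
    rw [hz ht hx, abs_zero, Real.zero_rpow hp]

/-- The constant relating `coneWeight` to the integral of `e^{l x_a}` over `B_{R + t}`. -/
def sectionConst (n : ℕ) (l R : ℝ) : ℝ :=
  2 / l * √(4 * Real.pi / l) ^ (n - 1) * Real.exp (l * R)

theorem sectionConst_pos (hl : 0 < l) : 0 < sectionConst n l R := by
  unfold sectionConst
  positivity

theorem setIntegral_planeExp_le_coneWeight {t : ℝ} (hl : 0 < l) (ht : 0 < R + t) :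
    ∫ x in Metric.closedBall 0 (R + t), planeExp a l x ≤
      sectionConst n l R * coneWeight l R (((n : ℝ) - 1) / 2) t := by
  refine (setIntegral_planeExp_le hl ht).trans_eq ?_
  rw [sectionConst, coneWeight, mul_add, Real.exp_add]
  ring

theorem IntegrableInCone.ae_mul_rpow_le_expMean {g : ℝ × Space n → ℝ} {Y : ℝ → ℝ} {k : ℝ}
    (hg : IntegrableInCone R B g) (hgp : IntegrableInCone R B fun z => |g z| ^ p) (hp : 1 ≤ p)
    (hl : 0 < l) (hR : 0 < R) (hk : 0 ≤ k) (hY : ∀ t, 0 ≤ t → 0 ≤ Y t)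
    (hYg : ∀ᵐ t, t ∈ Ioo 0 B → k * Y t ≤ expMean a l (R + B) g t) :
    ∀ᵐ t, t ∈ Ioo 0 B → k ^ p * sectionConst n l R ^ (1 - p) *
      (Y t ^ p * coneWeight l R (((n : ℝ) - 1) / 2) t ^ (1 - p)) ≤
        expMean a l (R + B) (fun z => |g z| ^ p) t := by
  filter_upwards [hYg, hg.ae_rpow_mul_rpow_le_expMean (a := a) (l := l) hgp hp] with t hYt
    hjensen ht
  have hRt : 0 < R + t := by linarith [ht.1]
  have hD : 0 < sectionConst n l R := sectionConst_pos hl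
  have hweight : 0 < coneWeight l R (((n : ℝ) - 1) / 2) t := by
    unfold coneWeight
    positivity
  have hYt0 := hY t ht.1.le
  calc _ = (k * Y t) ^ p *
          (sectionConst n l R * coneWeight l R (((n : ℝ) - 1) / 2) t) ^ (1 - p) := by
        rw [Real.mul_rpow hk hYt0, Real.mul_rpow hD.le hweight.le]
        ring
    _ ≤ _ := hjensen ht _ _ (mul_nonneg hk hYt0) (hYt ht) (by positivity)
        (setIntegral_planeExp_le_coneWeight hl hRt)

/-- The wave equation loses a factor `2` in the lower bound for the mean of `∂ₜv`, whence the
constant `2⁻¹ ^ p`. -/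
theorem IsSolution.exists_iterationFrame (hsol : IsSolution n b m p q f₀ f₁ g₀ g₁ T u v)
    (hu : SupportedInCone n R T u) (hv : SupportedInCone n R T v) (hp : 1 ≤ p) (hq : 1 ≤ q)
    (hm : |m| < l) (hR : 0 < R) (hB : 0 ≤ B) (hBT : (B : EReal) < T)
    (hf₀ : AdmissibleDatum a l R f₀) (hf₁ : AdmissibleDatum a l R f₁)
    (hg₀ : AdmissibleDatum a l R g₀) (hg₁ : AdmissibleDatum a l R g₁) :
    ∃ M N, IterationFrame p q l (|b| + l) R (((n : ℝ) - 1) / 2)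
      (2⁻¹ ^ p * sectionConst n l R ^ (1 - p)) (sectionConst n l R ^ (1 - q))
      (expMoment a l g₁) B M N := by
  obtain ⟨ut, vt, hut, hvt, hutq, hvtp, heq_u, heq_v⟩ := hsol.system
  have hl : 0 < l := (abs_nonneg m).trans_lt hm
  have hM0 : ∀ t, 0 ≤ expMean a l (R + B) (fun z => |vt z| ^ p) t :=
    expMean_nonneg fun z => Real.rpow_nonneg (abs_nonneg _) _
  have hN0 : ∀ t, 0 ≤ expMean a l (R + B) (fun z => |ut z| ^ q) t :=
    expMean_nonneg fun z => Real.rpow_nonneg (abs_nonneg _) _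
  have hut_cone := hut.integrableInCone hu hBT
  have hvt_cone := hvt.integrableInCone hv hBT
  have hutq_cone := hut.integrableInCone_rpow hu (by linarith) hutq hBT
  have hvtp_cone := hvt.integrableInCone_rpow hv (by linarith) hvtp hBT
  have hode_u := heq_u.solvesWeakODE_expMean (a := a) (l := l) hut
    (hu.integrableInCone hsol.continuous_u hBT) hut_cone hvtp_cone hBT hR.le hB hf₀.continuous
    hf₁.continuous hf₀.tsupport_subset hf₁.tsupport_subset
  have hode_v := heq_v.solvesWeakODE_expMean (a := a) (l := l) hvt
    (hv.integrableInCone hsol.continuous_v hBT) hvt_cone hutq_cone hBT hR.le hB hg₀.continuous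
    hg₁.continuous hg₀.tsupport_subset hg₁.tsupport_subset
  have hle_v := (zero_sub (l ^ 2) ▸ hode_v).ae_expPrimitive_le_two_mul_deriv hl
    hg₀.expMoment_nonneg hg₁.expMoment_nonneg hN0 hB
  refine ⟨_, _, hM0, hN0, hvtp_cone.integrableOn_expMean, hutq_cone.integrableOn_expMean,
    hvt_cone.ae_mul_rpow_le_expMean hvtp_cone hp hl hR (by norm_num)
      (fun t ht => expPrimitive_nonneg hg₁.expMoment_nonneg hN0 ht) ?_, ?_⟩
  · filter_upwards [hle_v] with t ht htB
    linarith [ht htB]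
  · simpa only [Real.one_rpow, one_mul] using
      hut_cone.ae_mul_rpow_le_expMean hutq_cone hq hl hR zero_le_one
        (fun t ht => expPrimitive_nonneg le_rfl hM0 ht) (by
          simpa only [one_mul] using hode_u.ae_expPrimitive_le_deriv hm hf₀.expMoment_nonneg
            hf₁.expMoment_nonneg hM0 hB)

theorem one_sub_mul_eq_mul_theta (hpq : 1 < p * q) :
    1 - ((n : ℝ) - 1) / 2 * (p * q - 1) = (p * q - 1) * theta n p q := by
  have : p * q - 1 ≠ 0 := by linarith
  rw [theta]
  field_simp

/-- The growth rate of the iteration for a solution of the system. -/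
def lifespanConst (n : ℕ) (b p q l R : ℝ) : ℝ :=
  sectionConst n l R ^ (1 - q) *
    (2⁻¹ ^ p * sectionConst n l R ^ (1 - p) * Real.exp (-(|b| + l + l))) ^ q *
      (1 + R) ^ (-(((n : ℝ) - 1) / 2 * (p * q - 1)))

theorem lifespanConst_pos (hl : 0 < l) (hR : 0 < R) : 0 < lifespanConst n b p q l R := by
  have : 0 < sectionConst n l R := sectionConst_pos hl
  unfold lifespanConst
  positivity

theorem IsSolution.le_mul_exp (hsol : IsSolution n b m p q f₀ f₁ g₀ g₁ T u v)
    (hu : SupportedInCone n R T u) (hv : SupportedInCone n R T v) (hp : 1 ≤ p) (hq : 1 ≤ q)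
    (hpq : 1 < p * q) (hθ : 0 ≤ theta n p q) (hm : |m| < l) (hR : 0 < R)
    (hf₀ : AdmissibleDatum a l R f₀) (hf₁ : AdmissibleDatum a l R f₁)
    (hg₀ : AdmissibleDatum a l R g₀) (hg₁ : AdmissibleDatum a l R g₁)
    (hg₁pos : 0 < expMoment a l g₁) {T₀ L : ℝ} (hT₀ : 1 ≤ T₀) (hL : 1 ≤ L)
    (hcond : 1 ≤ lifespanConst n b p q l R * T₀ ^ ((p * q - 1) * theta n p q) * L *
      expMoment a l g₁ ^ (p * q - 1)) :
    T ≤ ((T₀ * Real.exp (2 * L * (1 - sliceRatio (p * q) q)⁻¹) : ℝ) : EReal) := by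
  by_contra! hT
  have hl : 0 < l := (abs_nonneg m).trans_lt hm
  have hn : (1 : ℝ) ≤ n := by exact_mod_cast a.pos
  have hD : 0 < sectionConst n l R := sectionConst_pos hl
  have hκ : ((n : ℝ) - 1) / 2 * (p * q - 1) ≤ 1 := by
    linarith [one_sub_mul_eq_mul_theta (n := n) hpq,
      mul_nonneg (sub_nonneg.2 hpq.le) hθ]
  obtain ⟨M, N, h⟩ :=
    hsol.exists_iterationFrame hu hv hp hq hm hR (by positivity) hT hf₀ hf₁ hg₀ hg₁
  rw [← one_sub_mul_eq_mul_theta hpq] at hcond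
  exact lt_irrefl _ (h.lt_mul_exp hp hq hpq hR (by linarith) hκ (by positivity) (by positivity)
    (by positivity) hg₁pos hT₀ hL hcond)

end Solution

section Lifespan

variable {k P S θ s : ℝ}

theorem exists_one_le_mul_rpow_mul_rpow (hk : 0 < k) (hP : 0 ≤ P) (hs : 0 < s) :
    ∃ A : ℝ, 1 ≤ A ∧ ∀ ε : ℝ, 0 < ε → ε ≤ 1 →
      1 ≤ A * ε ^ (-(P / s)) ∧ 1 ≤ k * (A * ε ^ (-(P / s))) ^ s * ε ^ P := by
  refine ⟨max 1 (k⁻¹ ^ s⁻¹), le_max_left _ _, fun ε hε hε1 => ⟨?_, ?_⟩⟩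
  · exact one_le_mul_of_one_le_of_one_le (le_max_left _ _)
      (Real.one_le_rpow_of_pos_of_le_one_of_nonpos hε hε1 (neg_nonpos.2 (by positivity)))
  · have hε_cancel : (ε ^ (-(P / s))) ^ s * ε ^ P = 1 := by
      rw [← Real.rpow_mul hε.le, neg_mul, div_mul_cancel₀ P hs.ne', ← Real.rpow_add hε,
        neg_add_cancel, Real.rpow_zero]
    have hA : k⁻¹ ≤ max 1 (k⁻¹ ^ s⁻¹) ^ s := by
      calc k⁻¹ = (k⁻¹ ^ s⁻¹) ^ s := (Real.rpow_inv_rpow (by positivity) hs.ne').symm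
        _ ≤ max 1 (k⁻¹ ^ s⁻¹) ^ s := by gcongr; exact le_max_right _ _
    rw [Real.mul_rpow (by positivity) (by positivity), ← mul_assoc k, mul_assoc, hε_cancel, mul_one]
    exact (inv_le_iff_one_le_mul₀' hk).1 hA

/-- For `θ > 0` the starting time `T₀` is taken of order `ε ^ (-1 / θ)`; for `θ = 0` it is the
number `L` that grows, like `ε ^ (-P)`. -/
theorem exists_lifespan_bound (hk : 0 < k) (hP : 0 < P) (hS : 0 < S) (hθ : 0 ≤ θ) :
    ∃ C : ℝ, 0 < C ∧ ∀ (ε : ℝ) (T : EReal), 0 < ε → ε ≤ 1 →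
      (∀ T₀ L : ℝ, 1 ≤ T₀ → 1 ≤ L → 1 ≤ k * T₀ ^ (P * θ) * L * ε ^ P →
        T ≤ ((T₀ * Real.exp (2 * L * S) : ℝ) : EReal)) →
      T < ⊤ ∧ (0 < θ → T ≤ ((C * ε ^ (-(1 / θ)) : ℝ) : EReal)) ∧
        (θ = 0 → T ≤ ((Real.exp (C * ε ^ (-P)) : ℝ) : EReal)) := by
  rcases hθ.eq_or_lt with rfl | hθpos
  · obtain ⟨A, hA1, hA⟩ := exists_one_le_mul_rpow_mul_rpow hk hP.le one_pos
    refine ⟨2 * A * S, by positivity, fun ε T hε hε1 hT => ?_⟩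
    obtain ⟨hL, hcond⟩ := hA ε hε hε1
    have hbound := hT 1 _ le_rfl hL (by simpa using hcond)
    rw [one_mul, div_one, show 2 * (A * ε ^ (-P)) * S = 2 * A * S * ε ^ (-P) by ring] at hbound
    exact ⟨hbound.trans_lt (EReal.coe_lt_top _), fun h => absurd h (lt_irrefl 0), fun _ => hbound⟩
  · obtain ⟨A, hA1, hA⟩ := exists_one_le_mul_rpow_mul_rpow hk hP.le (mul_pos hP hθpos)
    refine ⟨A * Real.exp (2 * S), by positivity, fun ε T hε hε1 hT => ?_⟩
    obtain ⟨hT₀, hcond⟩ := hA ε hε hε1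
    have hbound := hT _ 1 hT₀ le_rfl (by simpa using hcond)
    rw [mul_one, ← div_div, div_self hP.ne', mul_right_comm] at hbound
    exact ⟨hbound.trans_lt (EReal.coe_lt_top _), fun _ => hbound, fun h => absurd h hθpos.ne'⟩

end Lifespan

end Nakao

end

theorem theorem1_general {n : ℕ} (a : Fin n) (b : ℝ) {p q R l : ℝ} (hp : 1 ≤ p) (hq : 1 ≤ q)
    (hpq : 1 < p * q) (hR : 0 < R) (hl : 0 < l) (hθ : 0 ≤ Nakao.theta n p q)
    {v₁ : Nakao.Space n → ℝ} (hv₁ : Nakao.AdmissibleDatum a l R v₁)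
    (hv₁_pos : 0 < Nakao.expMoment a l v₁) :
    ∃ C : ℝ, 0 < C ∧
      ∀ (m : ℝ) (u₀ u₁ v₀ : Nakao.Space n → ℝ), |m| < l →
        Nakao.AdmissibleDatum a l R u₀ → Nakao.AdmissibleDatum a l R u₁ →
        Nakao.AdmissibleDatum a l R v₀ →
        ∀ ε : ℝ, 0 < ε → ε ≤ 1 →
          ∀ (T : EReal) (u v : ℝ × Nakao.Space n → ℝ),
            Nakao.IsSolution n b m p q (fun x => ε * u₀ x) (fun x => ε * u₁ x)
              (fun x => ε * v₀ x) (fun x => ε * v₁ x) T u v →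
            Nakao.SupportedInCone n R T u → Nakao.SupportedInCone n R T v →
            T < ⊤ ∧
            (0 < Nakao.theta n p q →
              T ≤ ((C * ε ^ (-(1 / Nakao.theta n p q)) : ℝ) : EReal)) ∧
            (Nakao.theta n p q = 0 →
              T ≤ ((Real.exp (C * ε ^ (-(p * q - 1))) : ℝ) : EReal)) := by
  have hk : 0 < Nakao.lifespanConst n b p q l R * Nakao.expMoment a l v₁ ^ (p * q - 1) :=
    mul_pos (Nakao.lifespanConst_pos hl hR) (Real.rpow_pos_of_pos hv₁_pos _)
  have hS : 0 < (1 - Nakao.sliceRatio (p * q) q)⁻¹ :=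
    inv_pos.2 (sub_pos.2 (Nakao.sliceRatio_lt_one hpq (by linarith)))
  obtain ⟨C, hC, hbound⟩ := Nakao.exists_lifespan_bound hk (sub_pos.2 hpq) hS hθ
  refine ⟨C, hC, fun m u₀ u₁ v₀ hm hu₀ hu₁ hv₀ ε hε hε1 T u v hsol hu hv =>
    hbound ε T hε hε1 fun T₀ L hT₀ hL hcond => ?_⟩
  have hmoment := Nakao.expMoment_const_mul (a := a) (l := l) ε v₁
  refine hsol.le_mul_exp hu hv hp hq hpq hθ hm hR (hu₀.const_mul hε.le) (hu₁.const_mul hε.le)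
    (hv₀.const_mul hε.le) (hv₁.const_mul hε.le) (hmoment ▸ mul_pos hε hv₁_pos) hT₀ hL
    (hcond.trans_eq ?_)
  rw [hmoment, Real.mul_rpow hε.le hv₁_pos.le]
  ring

theorem theorem1 (n : ℕ) (hn : 1 ≤ n) (b p q R : ℝ) (hb : 0 < b) (hp : 1 < p) (hq : 1 < q)
    (hR : 0 < R) (hθ : 0 ≤ Nakao.theta n p q)
    (v₁ : Nakao.Space n → ℝ) (hv₁ : ContDiff ℝ 1 v₁) (hv₁_nonneg : ∀ x, 0 ≤ v₁ x)
    (hv₁_supp : tsupport v₁ ⊆ Metric.closedBall 0 R) (hv₁_ne : v₁ ≠ 0) :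
    ∃ ε₀ C : ℝ, 0 < ε₀ ∧ 0 < C ∧
      ∀ (m : ℝ) (u₀ u₁ v₀ : Nakao.Space n → ℝ), 4 * m ^ 2 ≤ b ^ 2 →
        ContDiff ℝ 2 u₀ → ContDiff ℝ 1 u₁ → ContDiff ℝ 2 v₀ →
        (∀ x, 0 ≤ u₀ x) → (∀ x, 0 ≤ u₁ x) → (∀ x, 0 ≤ v₀ x) →
        tsupport u₀ ⊆ Metric.closedBall 0 R → tsupport u₁ ⊆ Metric.closedBall 0 R →
        tsupport v₀ ⊆ Metric.closedBall 0 R →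
        ∀ ε : ℝ, 0 < ε → ε ≤ ε₀ →
          ∀ (T : EReal) (u v : ℝ × Nakao.Space n → ℝ), 0 < T →
            Nakao.IsSolution n b m p q (fun x => ε * u₀ x) (fun x => ε * u₁ x)
              (fun x => ε * v₀ x) (fun x => ε * v₁ x) T u v →
            Nakao.SupportedInCone n R T u → Nakao.SupportedInCone n R T v →
            T < ⊤ ∧
            (0 < Nakao.theta n p q →
              T ≤ ((C * ε ^ (-(1 / Nakao.theta n p q)) : ℝ) : EReal)) ∧
            (Nakao.theta n p q = 0 →
              T ≤ ((Real.exp (C * ε ^ (-(p * q - 1))) : ℝ) : EReal)) := by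
  have habs {m : ℝ} (hm : 4 * m ^ 2 ≤ b ^ 2) : |m| < b := abs_lt_of_sq_lt_sq (by nlinarith) hb.le
  obtain ⟨C, hC, hlife⟩ := theorem1_general ⟨0, hn⟩ b hp.le hq.le (one_lt_mul hp.le hq) hR hb hθ
    (Nakao.admissibleDatum_of_nonneg hv₁.continuous hv₁_supp hv₁_nonneg)
    (Nakao.expMoment_pos hv₁.continuous hv₁_supp hv₁_nonneg hv₁_ne)
  exact ⟨1, C, one_pos, hC, fun m u₀ u₁ v₀ hm hu₀ hu₁ hv₀ hu₀n hu₁n hv₀n hu₀s hu₁s hv₀s ε hε hε1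
    T u v _ => hlife m u₀ u₁ v₀ (habs hm)
      (Nakao.admissibleDatum_of_nonneg hu₀.continuous hu₀s hu₀n)
      (Nakao.admissibleDatum_of_nonneg hu₁.continuous hu₁s hu₁n)
      (Nakao.admissibleDatum_of_nonneg hv₀.continuous hv₀s hv₀n) ε hε hε1 T u v⟩
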